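/- For $p\in(1,\infty)$ and $q\in[0,1)$ let $$\mathrm K_{1,p}(q)=\int_0^{\pi/2}\frac{|\cos\theta|^{1-\frac2p}}{\sqrt{1-q^2\sin^2\theta}}\,d\theta,\qquad \mathrm E_{1,p}(q)=\int_0^{\pi/2}\sqrt{1-q^2\sin^2\theta}\,|\cos\theta|^{1-\frac2p}\,d\theta .$$ For every $p\in(1,\infty)$ the equation $2\,\mathrm E_{1,p}(q)/\mathrm K_{1,p}(q)-1=0$ has a unique solution $q=q^*(p)\in(0,1)$. Put $$\phi^*(p)=\pi-2\arcsin q^*(p),\qquad \varpi^*_p=2^{3p-1}\,q^*(p)^{p-2}\,\bigl(2q^*(p)^2-1\bigr)\,\mathrm E_{1,p}(q^*(p))^p .$$ Let $W^{2,p}_{\mathrm{imm}}(\mathbf T^1;\mathbf R^2)$, $\mathbf T^1=\mathbf R/\mathbf Z$, be the set of closed planar curves $\gamma$ of Sobolev class $W^{2,p}$ (identified with their continuous, hence $C^1$, representatives) with $\gamma'(t)\neq0$ for all $t$. For such $\gamma$ let $\mathcal L[\gamma]=\int_\gamma ds$ be the length, $k$ the signed curvature, and $\overline{\mathcal B}_p[\gamma]=\mathcal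 L[\gamma]^{p-1}\int_\gamma|k|^p\,ds$ the normalized $p$-bending energy. The curve $\gamma$ has a point $P\in\mathbf R^2$ of multiplicity $m$ if $\gamma^{-1}(P)$ contains at least $m$ distinct points. **Theorem.** For all integers $m,n$ with $m\ge3$ odd and $0<n<m/2$ there is a unique $p_{m,n}\in(1,\infty)$ with $\phi^*(p_{m,n})=\frac{n}{m}\pi$. Let $S\subset(1,\infty)$ be the set of all these exponents $p_{m,n}$. Then $S$ is dense in $(1,\infty)$. In addition, for all such $m,n$, with $p=p_{m,n}$, and for every odd integer $m'\ge m$, there exists a curve $\gamma\in W^{2,p}_{\mathrm{imm}}(\mathbf T^1;\mathbf R^2)$ with a point of multiplicity $m'$ such that $$\overline{\mathcal B}_p[\gamma]=\varpi^*_p\,(m')^p .$$ -/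

import Mathlib

open Set MeasureTheory
open scoped ContDiff

noncomputable section

namespace PElastica

/-! ### `p`-elliptic integrals and the modulus of the figure-eight -/

/-- The complete `p`-elliptic integral of the first kind `K_{1,p}(q)`, for `q ∈ [0,1)`. -/
def K1 (p q : ℝ) : ℝ :=
  ∫ θ in (0 : ℝ)..(Real.pi / 2),
    |Real.cos θ| ^ (1 - 2 / p) / Real.sqrt (1 - q ^ 2 * Real.sin θ ^ 2)

/-- The complete `p`-elliptic integral of the second kind `E_{1,p}(q)`. -/
def E1 (p q : ℝ) : ℝ :=
  ∫ θ in (0 : ℝ)..(Real.pi / 2),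
    Real.sqrt (1 - q ^ 2 * Real.sin θ ^ 2) * |Real.cos θ| ^ (1 - 2 / p)

/-- `Q_p(q) = 2 E_{1,p}(q) / K_{1,p}(q) - 1`. -/
def Q (p q : ℝ) : ℝ := 2 * (E1 p q / K1 p q) - 1

/-- `q` is a modulus of the figure-eight `p`-elastica: a zero of `Q_p` in `(0,1)`. -/
def IsFigureEightModulus (p q : ℝ) : Prop := q ∈ Ioo (0 : ℝ) 1 ∧ Q p q = 0

/-- `q^*(p)`, the solution `q ∈ (0,1)` of `Q_p(q) = 0`. (Its existence and uniqueness for `p > 1`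
is part of the main statement.) -/
def qStar (p : ℝ) : ℝ := Classical.epsilon (IsFigureEightModulus p)

/-- The crossing angle function `φ^*(p) = π - 2 arcsin q^*(p)`. -/
def phiStar (p : ℝ) : ℝ := Real.pi - 2 * Real.arcsin (qStar p)

/-- The constant `ϖ^*_p = 2^{3p-1} q^*(p)^{p-2} (2 q^*(p)^2 - 1) E_{1,p}(q^*(p))^p`. -/
def varpiStar (p : ℝ) : ℝ :=
  2 ^ (3 * p - 1) * qStar p ^ (p - 2) * (2 * qStar p ^ 2 - 1) * E1 p (qStar p) ^ p

/-! ### The exponents `p_{m,n}` -/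

/-- The pairs `(m, n)` with `m ≥ 3` odd and `0 < n < m / 2`. -/
def AdmissiblePair (m n : ℕ) : Prop := 3 ≤ m ∧ Odd m ∧ 0 < n ∧ (n : ℝ) < (m : ℝ) / 2

/-- `p ∈ (1,∞)` and `φ^*(p) = n π / m`, that is, `p = p_{m,n} = (φ^*)⁻¹(n π / m)`. -/
def IsExponent (m n : ℕ) (p : ℝ) : Prop := 1 < p ∧ phiStar p = (n : ℝ) / (m : ℝ) * Real.pi

/-- The set `S ⊆ (1,∞)` of all exponents `p_{m,n}`. -/
def exponentSet : Set ℝ := {p | ∃ m n : ℕ, AdmissiblePair m n ∧ IsExponent m n p}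

/-! ### Closed planar Sobolev curves -/

/-- The Euclidean plane. -/
abbrev Plane : Type := EuclideanSpace ℝ (Fin 2)

/-- `v` is the weak derivative of `u` on the circle `ℝ / ℤ`: for every smooth function `φ` on
the circle, `∫ φ' u = - ∫ φ v`. Smooth functions on the circle are the smooth `1`-periodic ones
on `ℝ`. -/
def HasWeakDeriv (u v : UnitAddCircle → Plane) : Prop :=
  ∀ φ : ℝ → ℝ, ContDiff ℝ ∞ φ → Function.Periodic φ 1 →
    ∫ t in (0 : ℝ)..1, deriv φ t • u (t : UnitAddCircle) =
      -∫ t in (0 : ℝ)..1, φ t • v (t : UnitAddCircle)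

/-- The Sobolev class `W^{2,p}(ℝ/ℤ; ℝ²)`: `u` and its first two weak derivatives lie in `L^p`. -/
def MemW2p (p : ℝ) (u : UnitAddCircle → Plane) : Prop :=
  ∃ v w : UnitAddCircle → Plane,
    MemLp u (ENNReal.ofReal p) volume ∧ MemLp v (ENNReal.ofReal p) volume ∧
      MemLp w (ENNReal.ofReal p) volume ∧ HasWeakDeriv u v ∧ HasWeakDeriv v w

/-- The `1`-periodic lift to `ℝ` of a closed curve. -/
def lift (γ : UnitAddCircle → Plane) : ℝ → Plane := fun t => γ (t : UnitAddCircle)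

/-- The velocity `γ'(t)`. -/
def velocity (γ : UnitAddCircle → Plane) : ℝ → Plane := deriv (lift γ)

/-- The acceleration `γ''(t)`. For the continuous representative `γ` of a `W^{2,p}` function,
`γ'` is absolutely continuous, and its pointwise derivative exists and equals the second weak
derivative almost everywhere. -/
def acceleration (γ : UnitAddCircle → Plane) : ℝ → Plane := deriv (velocity γ)

/-- The set of immersed closed `W^{2,p}`-curves. As usual a `W^{2,p}` function is identified with
its continuous representative, which is of class `C¹`. -/
def W2pImm (p : ℝ) : Set (UnitAddCircle → Plane) :=
  {γ | Continuous γ ∧ MemW2p p γ ∧ ∀ t : ℝ, velocity γ t ≠ 0}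

/-- The signed curvature `k = det (γ', γ'') / |γ'|³`. -/
def curvature (γ : UnitAddCircle → Plane) (t : ℝ) : ℝ :=
  (velocity γ t 0 * acceleration γ t 1 - velocity γ t 1 * acceleration γ t 0) /
    ‖velocity γ t‖ ^ 3

/-- The length `∫_γ ds`. -/
def length (γ : UnitAddCircle → Plane) : ℝ := ∫ t in (0 : ℝ)..1, ‖velocity γ t‖

/-- The `p`-bending energy `∫_γ |k|^p ds`. -/
def bendingEnergy (p : ℝ) (γ : UnitAddCircle → Plane) : ℝ :=
  ∫ t in (0 : ℝ)..1, |curvature γ t| ^ p * ‖velocity γ t‖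

/-- The normalized `p`-bending energy. -/
def normalizedBendingEnergy (p : ℝ) (γ : UnitAddCircle → Plane) : ℝ :=
  length γ ^ (p - 1) * bendingEnergy p γ

/-- `γ` has a point of multiplicity `m`: some `P` has at least `m` distinct preimages. -/
def HasPointOfMultiplicity (γ : UnitAddCircle → Plane) (m : ℕ) : Prop :=
  ∃ P : Plane, (m : ℕ∞) ≤ (γ ⁻¹' {P}).encard

end PElastica

end

namespace PElastica

open Real

/-! ### Integrals of powers of the cosine -/

/-! Moduli. With s = 1 - 2/p ∈ (-1, 1), the equation 2E = K says that `defect s q`, the integral of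
|cos|^s against `kernelFun (q² sin²)`, vanishes. The kernel is strictly decreasing, hence so is the
defect in q, and a zero is unique. The defect is positive at q = 0; that it becomes negative before
q = 1 is proved first for s ∈ (0, 1), where q = 1 itself can be evaluated, and then for all s by
`defect_neg_of_exponent_lt`. This comparison of exponents also makes q^* strictly increasing in p.
Conversely, when 1 < 2q² < 2 the defect is negative for s near -1 and positive at s = 1, so every
such q is some q^*(p). Hence φ^* is a decreasing bijection from (1, ∞) onto (0, π/2). This gives the
exponents p_{m,n}, and their density follows from that of fractions with odd denominator.

Curves. A half period of the figure-eight `p`-elastica is a loop based at the origin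
(`exists_loop`): its tangent angle is 2 arcsin(q sin x) up to a constant, and 2E = K is exactly its
closing condition. Its curvature vanishes at both ends, so congruent or reflected copies can be
joined with continuous curvature (`exists_closed_curve_of_loop`). Each copy starts and ends at the
origin, so m' copies give multiplicity m'; at unit length per loop the energy is m'^p times that of
one loop, and the latter is ϖ^*_p. One loop turns by 4 arcsin q^* = 2π(1 - n/m). Choosing signs
whose sum is m makes the total turning 2π(m - n), so the tangent closes up too. Since m' - m is
even, such signs exist. -/

lemma half_pi_nonneg : (0 : ℝ) ≤ π / 2 := by positivity

lemma cos_pos_of_mem_Ioo_zero {θ : ℝ} (hθ : θ ∈ Ioo 0 (π / 2)) : 0 < cos θ :=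
  cos_pos_of_mem_Ioo ⟨by linarith [hθ.1, pi_pos], hθ.2⟩

lemma sin_pos_of_mem_Ioo_zero {θ : ℝ} (hθ : θ ∈ Ioo 0 (π / 2)) : 0 < sin θ :=
  sin_pos_of_mem_Ioo ⟨hθ.1, by linarith [hθ.2, pi_pos]⟩

/-- A power of `|cos|` with exponent above `-1` is integrable up to the zero of the cosine. -/
lemma intervalIntegrable_abs_cos_rpow {s : ℝ} (hs : -1 < s) :
    IntervalIntegrable (fun θ => |cos θ| ^ s) volume 0 (π / 2) := by
  rcases le_or_gt 0 s with h0 | h0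
  · exact ((continuous_cos.abs).rpow_const fun _ => Or.inr h0).intervalIntegrable _ _
  -- For s < 0 Jordan's inequality cos θ ≥ (2/π)(π/2 - θ) gives an integrable power of the distance
  -- to π/2 as majorant.
  have h1 : IntervalIntegrable (fun x : ℝ => (2 / π * x) ^ s) volume (π / 2 - 0) (π / 2 - π / 2) := by
    have := (intervalIntegral.intervalIntegrable_rpow' (a := π / 2 - 0) (b := π / 2 - π / 2) hs).const_mul
      ((2 / π) ^ s)
    refine this.congr_uIoo fun x hx => ?_
    have hx0 : 0 ≤ x := by
      rw [sub_self, sub_zero, uIoo_of_ge half_pi_nonneg] at hx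
      exact hx.1.le
    simp only
    rw [mul_rpow (by positivity) hx0]
  have h2 := h1.comp_sub_left (π / 2)
  rw [sub_sub_cancel, sub_sub_cancel] at h2
  refine h2.mono_fun' ?_ ?_
  · exact (by fun_prop : Measurable fun θ => |cos θ| ^ s).aestronglyMeasurable
  · rw [uIoc_of_le half_pi_nonneg]
    refine (ae_restrict_iff' measurableSet_Ioc).2 ?_
    filter_upwards [(Set.countable_singleton (π / 2)).ae_notMem volume] with θ hne hθ
    have hlt : θ < π / 2 := lt_of_le_of_ne hθ.2 hne
    have hc := cos_pos_of_mem_Ioo_zero ⟨hθ.1, hlt⟩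
    have hb : 0 < 2 / π * (π / 2 - θ) := mul_pos (by positivity) (by linarith)
    have hle : 2 / π * (π / 2 - θ) ≤ |cos θ| := by
      rw [abs_of_pos hc]
      have := one_sub_mul_le_cos hθ.1.le hθ.2
      have h3 : 2 / π * (π / 2 - θ) = 1 - 2 / π * θ := by
        field_simp
      linarith
    rw [norm_of_nonneg (by positivity)]
    exact rpow_le_rpow_of_nonpos hb hle h0.le

/-- The recursion `(s + 2) ∫ cos^(s+2) = (s + 1) ∫ cos^s`. -/
lemma integral_abs_cos_rpow_add_two {s : ℝ} (hs : -1 < s) :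
    (s + 2) * ∫ θ in (0 : ℝ)..(π / 2), |cos θ| ^ (s + 2) =
      (s + 1) * ∫ θ in (0 : ℝ)..(π / 2), |cos θ| ^ s := by
  have h1 := (intervalIntegrable_abs_cos_rpow (s := s + 2) (by linarith)).const_mul (s + 2)
  have h2 := (intervalIntegrable_abs_cos_rpow hs).const_mul (s + 1)
  -- Integrate the derivative of sin · cos^(s+1); both boundary values vanish because s + 1 > 0.
  have key := intervalIntegral.integral_eq_sub_of_hasDerivAt_of_le
    (f := fun θ => sin θ * |cos θ| ^ (s + 1))
    (f' := fun θ => (s + 2) * |cos θ| ^ (s + 2) - (s + 1) * |cos θ| ^ s) half_pi_nonneg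
    ?_ ?_ (h1.sub h2)
  · rw [intervalIntegral.integral_sub h1 h2, intervalIntegral.integral_const_mul,
      intervalIntegral.integral_const_mul] at key
    simp only [cos_pi_div_two, abs_zero, sin_zero, zero_mul, sub_zero] at key
    rw [zero_rpow (by linarith), mul_zero] at key
    linarith
  · exact (continuous_sin.mul (continuous_cos.abs.rpow_const fun _ =>
      Or.inr (by linarith))).continuousOn
  · intro θ hθ
    have hc := cos_pos_of_mem_Ioo_zero hθ
    have hd : HasDerivAt (fun θ => sin θ * cos θ ^ (s + 1))
        (cos θ * cos θ ^ (s + 1) + sin θ * (-sin θ * (s + 1) * cos θ ^ (s + 1 - 1))) θ :=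
      (hasDerivAt_sin θ).mul ((hasDerivAt_cos θ).rpow_const (Or.inl hc.ne'))
    have hval : cos θ * cos θ ^ (s + 1) + sin θ * (-sin θ * (s + 1) * cos θ ^ (s + 1 - 1)) =
        (s + 2) * |cos θ| ^ (s + 2) - (s + 1) * |cos θ| ^ s := by
      rw [abs_of_pos hc, add_sub_cancel_right, rpow_add hc, rpow_add hc, rpow_one, rpow_two]
      have := sin_sq_add_cos_sq θ
      linear_combination (-(s + 1) * cos θ ^ s) * this
    rw [← hval]
    refine hd.congr_of_eventuallyEq ?_
    filter_upwards [isOpen_Ioo.mem_nhds hθ] with x hx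
    rw [abs_of_pos (cos_pos_of_mem_Ioo_zero hx)]

lemma integral_abs_cos_rpow_pos {s : ℝ} (hs : -1 < s) :
    0 < ∫ θ in (0 : ℝ)..(π / 2), |cos θ| ^ s :=
  intervalIntegral.intervalIntegral_pos_of_pos_on (intervalIntegrable_abs_cos_rpow hs)
    (fun θ hθ => rpow_pos_of_pos (abs_pos.2 (cos_pos_of_mem_Ioo_zero hθ).ne') _) (by positivity)

/-! ### The function whose sign change in the modulus defines `q^*` -/

/-- The integrand `(1 - 2 x) / √(1 - x)` with `x = q² sin² θ`. -/
noncomputable def kernelFun (x : ℝ) : ℝ := (1 - 2 * x) / √(1 - x)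

/-- The weighted integral `2 E - K` with weight `|cos| ^ s`. -/
noncomputable def defect (s q : ℝ) : ℝ :=
  ∫ θ in (0 : ℝ)..(π / 2), |cos θ| ^ s * kernelFun (q ^ 2 * sin θ ^ 2)

lemma kernelFun_strictAntiOn : StrictAntiOn kernelFun (Iio 1) := by
  intro x hx y hy hxy
  have hx1 : 0 < √(1 - x) := sqrt_pos.2 (by linarith [mem_Iio.1 hx])
  have hy1 : 0 < √(1 - y) := sqrt_pos.2 (by linarith [mem_Iio.1 hy])
  have hlt : √(1 - y) < √(1 - x) := sqrt_lt_sqrt (by linarith [mem_Iio.1 hy]) (by linarith)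
  have e : ∀ z : ℝ, z < 1 → kernelFun z = 2 * √(1 - z) - 1 / √(1 - z) := by
    intro z hz
    have hz1 : 0 < √(1 - z) := sqrt_pos.2 (by linarith)
    have := sq_sqrt (show 0 ≤ 1 - z by linarith)
    rw [kernelFun]
    field_simp
    linarith
  rw [e x hx, e y hy]
  have := one_div_lt_one_div_of_lt hy1 hlt
  linarith

/-- The line is the tangent at the zero x = 1/2. After multiplication by √(1 - x), the factor √(2(1
- x)) crosses 1 exactly where 1 - 2x changes sign. -/
lemma kernelFun_le_tangent {x : ℝ} (hx : x < 1) : kernelFun x ≤ √2 * (1 - 2 * x) := by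
  have h1 : 0 < √(1 - x) := sqrt_pos.2 (by linarith)
  rw [kernelFun, div_le_iff₀ h1]
  have h2 : √2 * √(1 - x) = √(2 * (1 - x)) := (sqrt_mul (by norm_num) _).symm
  rw [mul_right_comm, h2]
  rcases le_total x (1 / 2) with h | h
  · have : 1 ≤ √(2 * (1 - x)) := one_le_sqrt.2 (by linarith)
    nlinarith
  · have : √(2 * (1 - x)) ≤ 1 := sqrt_le_one.2 (by linarith)
    nlinarith

lemma sq_mul_sin_sq_lt_one {q : ℝ} (hq : q ∈ Ico (0 : ℝ) 1) (θ : ℝ) : q ^ 2 * sin θ ^ 2 < 1 := by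
  have h1 := sin_sq_le_one θ
  have h2 : q ^ 2 < 1 := by nlinarith [hq.1, hq.2]
  nlinarith [sq_nonneg (sin θ), sq_nonneg q]

lemma continuousOn_kernelFun : ContinuousOn kernelFun (Iio 1) := by
  refine ContinuousOn.div (by fun_prop) (by fun_prop) fun x hx => ?_
  exact (sqrt_pos.2 (by linarith [mem_Iio.1 hx])).ne'

lemma continuous_kernelFun_comp {q : ℝ} (hq : q ∈ Ico (0 : ℝ) 1) :
    Continuous fun θ => kernelFun (q ^ 2 * sin θ ^ 2) :=
  continuousOn_kernelFun.comp_continuous (by fun_prop) (sq_mul_sin_sq_lt_one hq)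

lemma intervalIntegrable_defect {s q : ℝ} (hs : -1 < s) (hq : q ∈ Ico (0 : ℝ) 1) :
    IntervalIntegrable (fun θ => |cos θ| ^ s * kernelFun (q ^ 2 * sin θ ^ 2)) volume 0 (π / 2) :=
  (intervalIntegrable_abs_cos_rpow hs).mul_continuousOn (continuous_kernelFun_comp hq).continuousOn

lemma defect_strictAntiOn {s : ℝ} (hs : -1 < s) : StrictAntiOn (defect s) (Ico 0 1) := by
  intro q hq r hr hqr
  rw [← sub_pos, defect, defect,
    ← intervalIntegral.integral_sub (intervalIntegrable_defect hs hq) (intervalIntegrable_defect hs hr)]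
  refine intervalIntegral.intervalIntegral_pos_of_pos_on
    ((intervalIntegrable_defect hs hq).sub (intervalIntegrable_defect hs hr)) (fun θ hθ => ?_)
    (by positivity)
  have hc := cos_pos_of_mem_Ioo_zero hθ
  have hsin := sin_pos_of_mem_Ioo_zero hθ
  rw [← mul_sub]
  refine mul_pos (rpow_pos_of_pos (abs_pos.2 hc.ne') _) (sub_pos.2 ?_)
  refine kernelFun_strictAntiOn (sq_mul_sin_sq_lt_one hq θ) (sq_mul_sin_sq_lt_one hr θ) ?_
  have : q ^ 2 < r ^ 2 := by nlinarith [hq.1]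
  exact mul_lt_mul_of_pos_right this (by positivity)

lemma defect_zero_pos {s : ℝ} (hs : -1 < s) : 0 < defect s 0 := by
  simpa [defect, kernelFun] using integral_abs_cos_rpow_pos hs

/-- Here q² sin² stays below 1/2 on the open interval, so the kernel is positive there. This forces
q^* > 1/√2. -/
lemma defect_pos_of_two_mul_sq_le {s q : ℝ} (hs : -1 < s) (hq : q ∈ Ico (0 : ℝ) 1)
    (h : 2 * q ^ 2 ≤ 1) : 0 < defect s q := by
  refine intervalIntegral.intervalIntegral_pos_of_pos_on (intervalIntegrable_defect hs hq)
    (fun θ hθ => ?_) (by positivity)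
  have hc := cos_pos_of_mem_Ioo_zero hθ
  have h1 := sin_sq_add_cos_sq θ
  refine mul_pos (rpow_pos_of_pos (abs_pos.2 hc.ne') _) (div_pos ?_ (sqrt_pos.2 ?_))
  · nlinarith [mul_pos hc hc]
  · linarith [sq_mul_sin_sq_lt_one hq θ]

/-- Replacing the kernel by its tangent reduces the integral to cosine powers, and the recursion
evaluates the bound as √2 (s + 2 - 2q²)/(s + 2) times ∫ cos^s. -/
lemma defect_neg_of_lt {s q : ℝ} (hs : -1 < s) (hq : q ∈ Ico (0 : ℝ) 1) (h : s + 2 < 2 * q ^ 2) :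
    defect s q < 0 := by
  have i0 := intervalIntegrable_abs_cos_rpow hs
  have i2 := intervalIntegrable_abs_cos_rpow (s := s + 2) (by linarith)
  have hle : defect s q ≤ ∫ θ in (0 : ℝ)..(π / 2),
      (√2 * (1 - 2 * q ^ 2) * |cos θ| ^ s + √2 * (2 * q ^ 2) * |cos θ| ^ (s + 2)) := by
    refine intervalIntegral.integral_mono_on_of_le_Ioo half_pi_nonneg (intervalIntegrable_defect hs hq)
      ((i0.const_mul _).add (i2.const_mul _)) fun θ hθ => ?_
    have hc := cos_pos_of_mem_Ioo_zero hθ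
    have h1 := kernelFun_le_tangent (sq_mul_sin_sq_lt_one hq θ)
    have h2 := mul_le_mul_of_nonneg_left h1 (rpow_pos_of_pos (abs_pos.2 hc.ne') s).le
    refine h2.trans_eq ?_
    rw [abs_of_pos hc, rpow_add hc, rpow_two, cos_sq']
    ring
  rw [intervalIntegral.integral_add (i0.const_mul _) (i2.const_mul _),
    intervalIntegral.integral_const_mul, intervalIntegral.integral_const_mul] at hle
  have hrec := integral_abs_cos_rpow_add_two hs
  have hpos := integral_abs_cos_rpow_pos hs
  set I := ∫ θ in (0 : ℝ)..(π / 2), |cos θ| ^ s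
  set J := ∫ θ in (0 : ℝ)..(π / 2), |cos θ| ^ (s + 2)
  have h3 : (s + 2) * ((1 - 2 * q ^ 2) * I + 2 * q ^ 2 * J) = (s + 2 - 2 * q ^ 2) * I := by
    linear_combination 2 * q ^ 2 * hrec
  have h4 : (1 - 2 * q ^ 2) * I + 2 * q ^ 2 * J < 0 := by
    have : (s + 2 - 2 * q ^ 2) * I < 0 := mul_neg_of_neg_of_pos (by linarith) hpos
    by_contra! h5
    nlinarith
  have h6 : √2 * ((1 - 2 * q ^ 2) * I + 2 * q ^ 2 * J) < 0 :=
    mul_neg_of_pos_of_neg (by positivity) h4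
  linarith

/-- Raising the exponent of the weight favours the part where the kernel is positive. -/
lemma defect_neg_of_exponent_lt {s s' q : ℝ} (hs : -1 < s) (hss : s < s') (hq : q ∈ Ico (0 : ℝ) 1)
    (h : defect s' q ≤ 0) : defect s q < 0 := by
  have hs' : -1 < s' := hs.trans hss
  have hq2 : 1 < 2 * q ^ 2 := by
    by_contra! hle
    exact absurd h (not_le.2 (defect_pos_of_two_mul_sq_le hs' hq hle))
  have hq0 : 0 < q := lt_of_le_of_ne hq.1 (by rintro rfl; norm_num at hq2)
  -- The kernel changes sign once, at the angle c with sin c = a, that is q² sin² c = 1/2.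
  set a : ℝ := 1 / (√2 * q) with ha
  have ha0 : 0 < a := by positivity
  have ha2 : q ^ 2 * a ^ 2 = 1 / 2 := by
    have := sq_sqrt (show (0 : ℝ) ≤ 2 by norm_num)
    rw [ha]; field_simp; linarith
  have ha1 : a < 1 := by
    by_contra! h1
    nlinarith [mul_nonneg (sq_nonneg q) (sub_nonneg.2 (one_le_pow₀ h1 (n := 2)))]
  set c := arcsin a with hc
  have hsc : sin c = a := sin_arcsin (by linarith) ha1.le
  have hc0 : 0 < c := arcsin_pos.2 ha0
  have hc1 : c < π / 2 := arcsin_lt_pi_div_two.2 ha1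
  have hcc : 0 < cos c := cos_pos_of_mem_Ioo_zero ⟨hc0, hc1⟩
  -- Subtracting the multiple cos^(s'-s) c makes the weight factor change sign at c together with
  -- the kernel, so f is positive on both sides of c.
  set f : ℝ → ℝ := fun θ => |cos θ| ^ s' * kernelFun (q ^ 2 * sin θ ^ 2) -
    cos c ^ (s' - s) * (|cos θ| ^ s * kernelFun (q ^ 2 * sin θ ^ 2)) with hf
  have i1 := intervalIntegrable_defect hs' hq
  have i2 := (intervalIntegrable_defect hs hq).const_mul (cos c ^ (s' - s))
  have hfi : IntervalIntegrable f volume 0 (π / 2) := i1.sub i2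
  have hfe : ∀ θ ∈ Ioo 0 (π / 2), f θ =
      cos θ ^ s * ((cos θ ^ (s' - s) - cos c ^ (s' - s)) * kernelFun (q ^ 2 * sin θ ^ 2)) := by
    intro θ hθ
    have hcθ := cos_pos_of_mem_Ioo_zero hθ
    simp only [hf]
    rw [abs_of_pos hcθ, rpow_sub hcθ]
    field_simp
  have hpos1 : ∀ θ ∈ Ioo 0 c, 0 < f θ := by
    intro θ hθ
    have hθ' : θ ∈ Ioo 0 (π / 2) := ⟨hθ.1, hθ.2.trans hc1⟩
    have hcθ := cos_pos_of_mem_Ioo_zero hθ'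
    have hsθ := sin_pos_of_mem_Ioo_zero hθ'
    rw [hfe θ hθ']
    have h1 : cos c < cos θ := cos_lt_cos_of_nonneg_of_le_pi_div_two hθ.1.le hc1.le hθ.2
    have h2 : sin θ < a := hsc ▸ sin_lt_sin_of_lt_of_le_pi_div_two (by linarith [hθ.1, pi_pos]) hc1.le hθ.2
    have h3 : q ^ 2 * sin θ ^ 2 < 1 / 2 := by
      rw [← ha2]
      exact mul_lt_mul_of_pos_left (by nlinarith) (by positivity)
    refine mul_pos (rpow_pos_of_pos hcθ _) (mul_pos (sub_pos.2 ?_) (div_pos (by linarith) (sqrt_pos.2 (by linarith))))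
    exact rpow_lt_rpow hcc.le h1 (by linarith)
  have hpos2 : ∀ θ ∈ Ioo c (π / 2), 0 < f θ := by
    intro θ hθ
    have hθ' : θ ∈ Ioo 0 (π / 2) := ⟨hc0.trans hθ.1, hθ.2⟩
    have hcθ := cos_pos_of_mem_Ioo_zero hθ'
    have hsθ := sin_pos_of_mem_Ioo_zero hθ'
    rw [hfe θ hθ']
    have h1 : cos θ < cos c := cos_lt_cos_of_nonneg_of_le_pi_div_two hc0.le hθ.2.le hθ.1
    have h2 : a < sin θ := hsc ▸ sin_lt_sin_of_lt_of_le_pi_div_two (by linarith [pi_pos]) hθ.2.le hθ.1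
    have h3 : 1 / 2 < q ^ 2 * sin θ ^ 2 := by
      rw [← ha2]
      exact mul_lt_mul_of_pos_left (by nlinarith) (by positivity)
    refine mul_pos (rpow_pos_of_pos hcθ _) (mul_pos_of_neg_of_neg (sub_neg.2 ?_)
      (div_neg_of_neg_of_pos (by linarith) (sqrt_pos.2 (by linarith [sq_mul_sin_sq_lt_one hq θ]))))
    exact rpow_lt_rpow hcθ.le h1 (by linarith)
  have hsub1 : uIcc 0 c ⊆ uIcc 0 (π / 2) := by
    rw [uIcc_of_le hc0.le, uIcc_of_le half_pi_nonneg]; exact Icc_subset_Icc_right hc1.le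
  have hsub2 : uIcc c (π / 2) ⊆ uIcc 0 (π / 2) := by
    rw [uIcc_of_le hc1.le, uIcc_of_le half_pi_nonneg]; exact Icc_subset_Icc_left hc0.le
  have hfpos : 0 < ∫ θ in (0 : ℝ)..(π / 2), f θ := by
    rw [← intervalIntegral.integral_add_adjacent_intervals (hfi.mono_set hsub1) (hfi.mono_set hsub2)]
    exact add_pos
      (intervalIntegral.intervalIntegral_pos_of_pos_on (hfi.mono_set hsub1) hpos1 hc0)
      (intervalIntegral.intervalIntegral_pos_of_pos_on (hfi.mono_set hsub2) hpos2 hc1)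
  rw [hf, intervalIntegral.integral_sub i1 i2, intervalIntegral.integral_const_mul] at hfpos
  change 0 < defect s' q - cos c ^ (s' - s) * defect s q at hfpos
  by_contra! hge
  have := mul_nonneg (rpow_pos_of_pos hcc (s' - s)).le hge
  linarith

/-- For s = 1 the integrand is the derivative of sin θ √(1 - q² sin² θ), so the integral is √(1 -
q²). -/
lemma defect_one_pos {q : ℝ} (hq : q ∈ Ico (0 : ℝ) 1) : 0 < defect 1 q := by
  have key := intervalIntegral.integral_eq_sub_of_hasDerivAt_of_le
    (f := fun θ => sin θ * √(1 - q ^ 2 * sin θ ^ 2))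
    (f' := fun θ => |cos θ| ^ (1 : ℝ) * kernelFun (q ^ 2 * sin θ ^ 2)) half_pi_nonneg
    (by fun_prop) ?_ (intervalIntegrable_defect (by norm_num) hq)
  · rw [defect, key]
    simp only [sin_pi_div_two, sin_zero, zero_mul, sub_zero]
    have := sq_mul_sin_sq_lt_one hq (π / 2)
    rw [sin_pi_div_two] at this
    rw [one_mul]
    exact sqrt_pos.2 (by linarith)
  · intro θ hθ
    have hc := cos_pos_of_mem_Ioo_zero hθ
    have h1 : 0 < 1 - q ^ 2 * sin θ ^ 2 := by linarith [sq_mul_sin_sq_lt_one hq θ]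
    have hd := (hasDerivAt_sin θ).mul
      (((((hasDerivAt_sin θ).pow 2).const_mul (q ^ 2)).const_sub 1).sqrt h1.ne')
    refine hd.congr_deriv ?_
    have h2 := sqrt_pos.2 h1
    have h3 := sq_sqrt h1.le
    simp only [Nat.cast_ofNat, Nat.add_one_sub_one, pow_one, Pi.pow_apply]
    rw [abs_of_pos hc, rpow_one, kernelFun]
    field_simp
    linear_combination h3

lemma continuousOn_defect_exponent {q s₀ : ℝ} (hs₀ : -1 < s₀) (hq : q ∈ Ico (0 : ℝ) 1) :
    ContinuousOn (fun s => defect s q) (Ici s₀) := by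
  intro s hs
  refine intervalIntegral.continuousWithinAt_of_dominated_interval
    (bound := fun θ => |cos θ| ^ s₀ * |kernelFun (q ^ 2 * sin θ ^ 2)|) ?_ ?_ ?_ ?_
  · filter_upwards [self_mem_nhdsWithin] with t ht
    have h := (intervalIntegrable_defect (lt_of_lt_of_le hs₀ ht) hq).aestronglyMeasurable
    rwa [uIoc_of_le half_pi_nonneg]
  · filter_upwards [self_mem_nhdsWithin] with t ht
    filter_upwards [(Set.countable_singleton (π / 2)).ae_notMem volume] with θ hne hθ
    rw [uIoc_of_le half_pi_nonneg] at hθ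
    have hc := cos_pos_of_mem_Ioo_zero ⟨hθ.1, lt_of_le_of_ne hθ.2 hne⟩
    rw [norm_mul, norm_of_nonneg (by positivity), norm_eq_abs]
    exact mul_le_mul_of_nonneg_right
      (rpow_le_rpow_of_exponent_ge (abs_pos.2 hc.ne') (abs_cos_le_one θ) ht) (abs_nonneg _)
  · exact (intervalIntegrable_abs_cos_rpow hs₀).mul_continuousOn
      (continuous_kernelFun_comp hq).abs.continuousOn
  · filter_upwards [(Set.countable_singleton (π / 2)).ae_notMem volume] with θ hne hθ
    rw [uIoc_of_le half_pi_nonneg] at hθ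
    have hc := cos_pos_of_mem_Ioo_zero ⟨hθ.1, lt_of_le_of_ne hθ.2 hne⟩
    exact ((continuous_const_rpow (abs_pos.2 hc.ne').ne').mul continuous_const).continuousWithinAt

lemma sq_mul_sin_sq_le {q θ : ℝ} (hq : q ∈ Icc (0 : ℝ) 1) : q ^ 2 * sin θ ^ 2 ≤ sin θ ^ 2 := by
  have : q ^ 2 ≤ 1 := by nlinarith [hq.1, hq.2]
  nlinarith [sq_nonneg (sin θ)]

/-- Since √(1 - q² sin²) ≥ cos, the function cos^(s-1) dominates uniformly up to q = 1; it is
integrable because s > 0. -/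
lemma continuousOn_defect_modulus {s : ℝ} (hs : 0 < s) : ContinuousOn (defect s) (Icc 0 1) := by
  have hlt : ∀ q ∈ Icc (0 : ℝ) 1, ∀ θ ∈ Ioo 0 (π / 2), q ^ 2 * sin θ ^ 2 < 1 := by
    intro q hq θ hθ
    have hc := cos_pos_of_mem_Ioo_zero hθ
    nlinarith [sq_mul_sin_sq_le (θ := θ) hq, sin_sq_add_cos_sq θ]
  intro q hq
  refine intervalIntegral.continuousWithinAt_of_dominated_interval
    (bound := fun θ => |cos θ| ^ (s - 1)) ?_ ?_ ?_ ?_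
  · filter_upwards with r
    unfold kernelFun
    exact (by fun_prop : Measurable fun θ => |cos θ| ^ s *
      ((1 - 2 * (r ^ 2 * sin θ ^ 2)) / √(1 - r ^ 2 * sin θ ^ 2))).aestronglyMeasurable
  · filter_upwards [self_mem_nhdsWithin] with r hr
    filter_upwards [(Set.countable_singleton (π / 2)).ae_notMem volume] with θ hne hθ
    rw [uIoc_of_le half_pi_nonneg] at hθ
    have hθ' : θ ∈ Ioo 0 (π / 2) := ⟨hθ.1, lt_of_le_of_ne hθ.2 hne⟩
    have hc := cos_pos_of_mem_Ioo_zero hθ'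
    have hx := hlt r hr θ hθ'
    have hx0 : 0 ≤ r ^ 2 * sin θ ^ 2 := by positivity
    have hle : cos θ ≤ √(1 - r ^ 2 * sin θ ^ 2) := by
      refine le_sqrt_of_sq_le ?_
      linarith [sq_mul_sin_sq_le (θ := θ) hr, sin_sq_add_cos_sq θ]
    rw [norm_mul, norm_of_nonneg (by positivity), norm_eq_abs, kernelFun, abs_div,
      abs_of_nonneg (sqrt_nonneg _), abs_of_pos hc, rpow_sub hc, rpow_one, div_eq_mul_one_div (cos θ ^ s)]
    gcongr
    exact abs_le.2 ⟨by linarith, by linarith⟩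
  · exact intervalIntegrable_abs_cos_rpow (by linarith)
  · filter_upwards [(Set.countable_singleton (π / 2)).ae_notMem volume] with θ hne hθ
    rw [uIoc_of_le half_pi_nonneg] at hθ
    have hθ' : θ ∈ Ioo 0 (π / 2) := ⟨hθ.1, lt_of_le_of_ne hθ.2 hne⟩
    refine ContinuousAt.continuousWithinAt (continuousAt_const.mul ?_)
    refine ContinuousAt.comp (f := fun r : ℝ => r ^ 2 * sin θ ^ 2)
      (continuousOn_kernelFun.continuousAt (isOpen_Iio.mem_nhds (hlt q hq θ hθ'))) (by fun_prop)

/-- At q = 1 the radical is cos, and the recursion turns the integral of 2 cos^(s+1) - cos^(s-1)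
into (s - 1)/(s + 1) times that of cos^(s-1). -/
lemma defect_one_neg {s : ℝ} (hs : 0 < s) (hs1 : s < 1) : defect s 1 < 0 := by
  have i0 := intervalIntegrable_abs_cos_rpow (s := s - 1) (by linarith)
  have i2 := intervalIntegrable_abs_cos_rpow (s := s - 1 + 2) (by linarith)
  have h : defect s 1 = ∫ θ in (0 : ℝ)..(π / 2), (2 * |cos θ| ^ (s - 1 + 2) - |cos θ| ^ (s - 1)) := by
    refine intervalIntegral.integral_congr_Ioo_of_le half_pi_nonneg fun θ hθ => ?_
    have hc := cos_pos_of_mem_Ioo_zero hθ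
    simp only [kernelFun]
    rw [one_pow, one_mul, ← cos_sq', sqrt_sq hc.le, abs_of_pos hc, rpow_add hc, rpow_sub hc, rpow_one,
      rpow_two, sin_sq]
    field_simp
    ring
  rw [h, intervalIntegral.integral_sub (i2.const_mul _) i0, intervalIntegral.integral_const_mul]
  have hrec := integral_abs_cos_rpow_add_two (s := s - 1) (by linarith)
  have hpos := integral_abs_cos_rpow_pos (s := s - 1) (by linarith)
  by_contra! hge
  nlinarith

/-- Existence of the modulus: for each exponent below `1` the defect vanishes somewhere. -/
lemma exists_defect_eq_zero {s : ℝ} (hs : -1 < s) (hs1 : s < 1) : ∃ q ∈ Ioo (0 : ℝ) 1, defect s q = 0 := by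
  -- For s ≤ 0 the majorant cos^(s-1) is not integrable. A zero r for a larger exponent t ∈ (0, 1)
  -- serves instead: there the defect for s is already negative, and r < 1 keeps the kernel bounded
  -- on [0, r].
  obtain ⟨t, ht0, ht1, hst⟩ : ∃ t : ℝ, 0 < t ∧ t < 1 ∧ s < t :=
    ⟨max ((s + 1) / 2) (1 / 2), by simp, by simp; constructor <;> linarith,
      lt_of_lt_of_le (by linarith) (le_max_left _ _)⟩
  obtain ⟨r, hr, hr0⟩ := intermediate_value_Ioo' zero_le_one (continuousOn_defect_modulus ht0)
    ⟨defect_one_neg ht0 ht1, defect_zero_pos (by linarith)⟩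
  have hrs : defect s r < 0 := defect_neg_of_exponent_lt hs hst ⟨hr.1.le, hr.2⟩ hr0.le
  have hcont : ContinuousOn (defect s) (Icc 0 r) := by
    intro q hq
    have hbd : ∀ x ∈ Icc (0 : ℝ) r, ∀ θ, x ^ 2 * sin θ ^ 2 ∈ Icc 0 (r ^ 2) := by
      intro x hx θ
      refine ⟨by positivity, ?_⟩
      have h1 : x ^ 2 ≤ r ^ 2 := by nlinarith [hx.1, hx.2]
      nlinarith [sin_sq_le_one θ, sq_nonneg x, sq_nonneg (sin θ)]
    have hr2 : r ^ 2 < 1 := by nlinarith [hr.1, hr.2]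
    have hk : ContinuousOn kernelFun (Icc 0 (r ^ 2)) :=
      continuousOn_kernelFun.mono fun x hx => lt_of_le_of_lt hx.2 hr2
    obtain ⟨C, hC⟩ := isCompact_Icc.exists_bound_of_continuousOn hk
    refine intervalIntegral.continuousWithinAt_of_dominated_interval
      (bound := fun θ => |cos θ| ^ s * C) ?_ ?_ ?_ ?_
    · filter_upwards [self_mem_nhdsWithin] with x hx
      have h := (intervalIntegrable_defect hs ⟨hx.1, lt_of_le_of_lt hx.2 hr.2⟩).aestronglyMeasurable
      rwa [uIoc_of_le half_pi_nonneg]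
    · filter_upwards [self_mem_nhdsWithin] with x hx
      refine Filter.Eventually.of_forall fun θ _ => ?_
      rw [norm_mul, norm_of_nonneg (by positivity)]
      exact mul_le_mul_of_nonneg_left (hC _ (hbd x hx θ)) (by positivity)
    · exact (intervalIntegrable_abs_cos_rpow hs).mul_const C
    · refine Filter.Eventually.of_forall fun θ _ => ContinuousWithinAt.mul continuousWithinAt_const ?_
      exact (hk _ (hbd q hq θ)).comp (f := fun x : ℝ => x ^ 2 * sin θ ^ 2) (by fun_prop)
        fun x hx => hbd x hx θ
  obtain ⟨q, hq, hq0⟩ := intermediate_value_Ioo' hr.1.le hcont ⟨hrs, defect_zero_pos hs⟩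
  exact ⟨q, ⟨hq.1, hq.2.trans hr.2⟩, hq0⟩

/-- Each modulus in `(1/√2, 1)` is attained by some exponent of the weight. -/
lemma exists_exponent_defect_eq_zero {q : ℝ} (hq : q ∈ Ico (0 : ℝ) 1) (h : 1 < 2 * q ^ 2) :
    ∃ s ∈ Ioo (-1 : ℝ) 1, defect s q = 0 := by
  have hq2 : q ^ 2 < 1 := by nlinarith [hq.1, hq.2]
  -- The midpoint of (-1, 2q² - 2), the range of exponents to which `defect_neg_of_lt` applies.
  set t : ℝ := q ^ 2 - 3 / 2 with ht
  have ht1 : -1 < t := by linarith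
  obtain ⟨s, hs, hs0⟩ := intermediate_value_Ioo (by linarith : t ≤ 1)
    ((continuousOn_defect_exponent ht1 hq).mono Icc_subset_Ici_self)
    ⟨defect_neg_of_lt ht1 hq (by linarith), defect_one_pos hq⟩
  exact ⟨s, ⟨ht1.trans hs.1, hs.2⟩, hs0⟩

/-! ### The modulus `q^*` and the crossing angle `φ^*` -/

lemma exponent_mem_Ioo {p : ℝ} (hp : 1 < p) : 1 - 2 / p ∈ Ioo (-1 : ℝ) 1 := by
  have h0 : 0 < 2 / p := by positivity
  have h1 : 2 / p < 2 := by rw [div_lt_iff₀ (by linarith)]; linarith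
  exact ⟨by linarith, by linarith⟩

lemma one_sub_sq_mul_sin_sq_pos {q : ℝ} (hq : q ∈ Ico (0 : ℝ) 1) (θ : ℝ) :
    0 < 1 - q ^ 2 * sin θ ^ 2 := sub_pos.2 (sq_mul_sin_sq_lt_one hq θ)

lemma intervalIntegrable_K1 {p q : ℝ} (hp : 1 < p) (hq : q ∈ Ico (0 : ℝ) 1) :
    IntervalIntegrable (fun θ => |cos θ| ^ (1 - 2 / p) / √(1 - q ^ 2 * sin θ ^ 2)) volume 0 (π / 2) := by
  simp_rw [div_eq_mul_inv]
  refine (intervalIntegrable_abs_cos_rpow (exponent_mem_Ioo hp).1).mul_continuousOn ?_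
  exact (Continuous.inv₀ (by fun_prop)
    fun θ => (sqrt_pos.2 (one_sub_sq_mul_sin_sq_pos hq θ)).ne').continuousOn

lemma intervalIntegrable_E1 {p q : ℝ} (hp : 1 < p) :
    IntervalIntegrable (fun θ => √(1 - q ^ 2 * sin θ ^ 2) * |cos θ| ^ (1 - 2 / p)) volume 0 (π / 2) :=
  (intervalIntegrable_abs_cos_rpow (exponent_mem_Ioo hp).1).continuousOn_mul (by fun_prop)

lemma K1_pos {p q : ℝ} (hp : 1 < p) (hq : q ∈ Ico (0 : ℝ) 1) : 0 < K1 p q :=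
  intervalIntegral.intervalIntegral_pos_of_pos_on (intervalIntegrable_K1 hp hq) (fun θ hθ => by
    have := sqrt_pos.2 (one_sub_sq_mul_sin_sq_pos hq θ)
    have := abs_pos.2 (cos_pos_of_mem_Ioo_zero hθ).ne'
    positivity) (by positivity)

lemma two_mul_E1_sub_K1 {p q : ℝ} (hp : 1 < p) (hq : q ∈ Ico (0 : ℝ) 1) :
    2 * E1 p q - K1 p q = defect (1 - 2 / p) q := by
  rw [E1, K1, ← intervalIntegral.integral_const_mul,
    ← intervalIntegral.integral_sub ((intervalIntegrable_E1 hp).const_mul 2) (intervalIntegrable_K1 hp hq),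
    defect]
  refine intervalIntegral.integral_congr fun θ _ => ?_
  have h1 := one_sub_sq_mul_sin_sq_pos hq θ
  have h2 := sqrt_pos.2 h1
  have h3 := sq_sqrt h1.le
  simp only [kernelFun]
  field_simp
  rw [h3]
  ring

lemma Q_eq_zero_iff {p q : ℝ} (hp : 1 < p) (hq : q ∈ Ico (0 : ℝ) 1) :
    Q p q = 0 ↔ defect (1 - 2 / p) q = 0 := by
  have hK := K1_pos hp hq
  rw [← two_mul_E1_sub_K1 hp hq, Q, sub_eq_zero, sub_eq_zero, ← mul_div_assoc, div_eq_one_iff_eq hK.ne']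

theorem existsUnique_isFigureEightModulus {p : ℝ} (hp : 1 < p) : ∃! q, IsFigureEightModulus p q := by
  obtain ⟨hs, hs1⟩ := exponent_mem_Ioo hp
  obtain ⟨q, hq, hq0⟩ := exists_defect_eq_zero hs hs1
  refine ⟨q, ⟨hq, (Q_eq_zero_iff hp ⟨hq.1.le, hq.2⟩).2 hq0⟩, fun r hr => ?_⟩
  have hr0 := (Q_eq_zero_iff hp ⟨hr.1.1.le, hr.1.2⟩).1 hr.2
  exact (defect_strictAntiOn hs).injOn ⟨hr.1.1.le, hr.1.2⟩ ⟨hq.1.le, hq.2⟩ (hr0.trans hq0.symm)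

lemma isFigureEightModulus_qStar {p : ℝ} (hp : 1 < p) : IsFigureEightModulus p (qStar p) :=
  Classical.epsilon_spec (existsUnique_isFigureEightModulus hp).exists

lemma qStar_mem_Ioo {p : ℝ} (hp : 1 < p) : qStar p ∈ Ioo (0 : ℝ) 1 :=
  (isFigureEightModulus_qStar hp).1

lemma qStar_mem_Ico {p : ℝ} (hp : 1 < p) : qStar p ∈ Ico (0 : ℝ) 1 :=
  Ioo_subset_Ico_self (qStar_mem_Ioo hp)

lemma defect_qStar {p : ℝ} (hp : 1 < p) : defect (1 - 2 / p) (qStar p) = 0 :=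
  (Q_eq_zero_iff hp (qStar_mem_Ico hp)).1 (isFigureEightModulus_qStar hp).2

lemma one_lt_two_mul_qStar_sq {p : ℝ} (hp : 1 < p) : 1 < 2 * qStar p ^ 2 := by
  by_contra! h
  exact (defect_pos_of_two_mul_sq_le (exponent_mem_Ioo hp).1 (qStar_mem_Ico hp) h).ne' (defect_qStar hp)

lemma qStar_lt_qStar {p p' : ℝ} (hp : 1 < p) (hpp : p < p') : qStar p < qStar p' := by
  have hp' := hp.trans hpp
  have hlt : 1 - 2 / p < 1 - 2 / p' := by
    have := div_lt_div_of_pos_left (a := (2 : ℝ)) (by norm_num) (by linarith) hpp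
    linarith
  have h := defect_neg_of_exponent_lt (exponent_mem_Ioo hp).1 hlt (qStar_mem_Ico hp')
    (defect_qStar hp').le
  by_contra! hle
  have := (defect_strictAntiOn (exponent_mem_Ioo hp).1).antitoneOn (qStar_mem_Ico hp')
    (qStar_mem_Ico hp) hle
  rw [defect_qStar hp] at this
  linarith

lemma phiStar_lt_phiStar {p p' : ℝ} (hp : 1 < p) (hpp : p < p') : phiStar p' < phiStar p := by
  have h := qStar_lt_qStar hp hpp
  have h1 := qStar_mem_Ioo hp
  have h2 := qStar_mem_Ioo (hp.trans hpp)
  have := strictMonoOn_arcsin (a := qStar p) (b := qStar p') ⟨by linarith [h1.1], h1.2.le⟩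
    ⟨by linarith [h2.1], h2.2.le⟩ h
  simp only [phiStar]
  linarith

lemma phiStar_mem_Ioo {p : ℝ} (hp : 1 < p) : phiStar p ∈ Ioo 0 (π / 2) := by
  obtain ⟨h0, h1⟩ := qStar_mem_Ioo hp
  have h2 := one_lt_two_mul_qStar_sq hp
  have h3 : arcsin (qStar p) < π / 2 := arcsin_lt_pi_div_two.2 h1
  have h4 : π / 4 < arcsin (qStar p) := by
    refine (lt_arcsin_iff_sin_lt' ⟨by linarith [pi_pos], by linarith [pi_pos]⟩).2 ?_
    rw [sin_pi_div_four]
    by_contra! h5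
    have := sq_sqrt (show (0 : ℝ) ≤ 2 by norm_num)
    nlinarith [sqrt_nonneg (2 : ℝ)]
  exact ⟨by simp only [phiStar]; linarith, by simp only [phiStar]; linarith⟩

/-- Prescribe the modulus q = sin((π - φ)/2) ∈ (1/√2, 1), find the exponent s for which it is a
zero, and solve 1 - 2/p = s for p; uniqueness of the modulus identifies q with `qStar p`. -/
lemma exists_phiStar_eq {φ : ℝ} (hφ : φ ∈ Ioo 0 (π / 2)) : ∃ p, 1 < p ∧ phiStar p = φ := by
  set q := sin ((π - φ) / 2) with hq
  have hπ := pi_pos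
  have hm : (π - φ) / 2 ∈ Ioo (π / 4) (π / 2) := ⟨by linarith [hφ.2], by linarith [hφ.1]⟩
  have hq1 : q < 1 := by
    rw [hq, ← sin_pi_div_two]
    exact sin_lt_sin_of_lt_of_le_pi_div_two (by linarith [hm.1]) le_rfl hm.2
  have hq0 : √2 / 2 < q := by
    rw [hq, ← sin_pi_div_four]
    exact sin_lt_sin_of_lt_of_le_pi_div_two (by linarith) hm.2.le hm.1
  have h2 := sq_sqrt (show (0 : ℝ) ≤ 2 by norm_num)
  have h20 : 0 < √2 := by positivity
  obtain ⟨s, hs, hs0⟩ := exists_exponent_defect_eq_zero (q := q) ⟨by linarith, hq1⟩ (by nlinarith)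
  set p := 2 / (1 - s) with hp
  have hs1 : 0 < 1 - s := by linarith [hs.2]
  have hp1 : 1 < p := by rw [hp, lt_div_iff₀ hs1]; linarith [hs.1]
  have hsp : 1 - 2 / p = s := by rw [hp]; field_simp; ring
  have hqs : qStar p = q := (existsUnique_isFigureEightModulus hp1).unique
    (isFigureEightModulus_qStar hp1)
    ⟨⟨by linarith, hq1⟩, (Q_eq_zero_iff hp1 ⟨by linarith, hq1⟩).2 (hsp ▸ hs0)⟩
  refine ⟨p, hp1, ?_⟩
  rw [phiStar, hqs, hq, arcsin_sin (by linarith [hm.1]) hm.2.le]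
  ring

lemma AdmissiblePair.angle_mem_Ioo {m n : ℕ} (h : AdmissiblePair m n) :
    (n : ℝ) / m * π ∈ Ioo 0 (π / 2) := by
  obtain ⟨hm, -, hn, hlt⟩ := h
  have hm0 : (0 : ℝ) < m := by exact_mod_cast (by omega : 0 < m)
  have hn0 : (0 : ℝ) < n := by exact_mod_cast hn
  have : (n : ℝ) / m < 1 / 2 := by rw [div_lt_iff₀ hm0]; linarith
  exact ⟨by positivity, by nlinarith [pi_pos]⟩

theorem existsUnique_isExponent {m n : ℕ} (h : AdmissiblePair m n) : ∃! p, IsExponent m n p := by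
  obtain ⟨p, hp, hφ⟩ := exists_phiStar_eq h.angle_mem_Ioo
  refine ⟨p, ⟨hp, hφ⟩, fun r ⟨hr, hrφ⟩ => ?_⟩
  rcases lt_trichotomy r p with hlt | heq | hgt
  · exact absurd (phiStar_lt_phiStar hr hlt) (by rw [hφ, hrφ]; exact lt_irrefl _)
  · exact heq
  · exact absurd (phiStar_lt_phiStar hp hgt) (by rw [hφ, hrφ]; exact lt_irrefl _)

/-- Fractions with odd denominator are dense in `(0, 1/2)`. -/
lemma exists_admissiblePair_between {a b : ℝ} (ha : 0 < a) (hab : a < b) (hb : b < 1 / 2) :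
    ∃ m n : ℕ, AdmissiblePair m n ∧ a < (n : ℝ) / m ∧ (n : ℝ) / m < b := by
  obtain ⟨k, hk⟩ := exists_nat_gt (1 / (b - a))
  have hba : 0 < b - a := sub_pos.2 hab
  have hk1 : 1 < k * (b - a) := by rwa [div_lt_iff₀ hba] at hk
  -- Odd, at least 3, and large enough that m(b - a) > 1; so ⌊am⌋ + 1 lies strictly between am and
  -- bm.
  set m := 2 * k + 3 with hm
  have hmr : (m : ℝ) = 2 * k + 3 := by rw [hm]; push_cast; ring
  have hm0 : (0 : ℝ) < m := by rw [hmr]; positivity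
  have hn1 := Nat.floor_le (mul_nonneg ha.le hm0.le)
  have hn2 := Nat.lt_floor_add_one (a * m)
  set n := ⌊a * m⌋₊ + 1 with hn
  have hnr : (n : ℝ) = ⌊a * m⌋₊ + 1 := by rw [hn]; push_cast; ring
  have h1 : (n : ℝ) < b * m := by
    have hk0 : (0 : ℝ) ≤ k := k.cast_nonneg
    nlinarith
  refine ⟨m, n, ⟨by omega, ⟨k + 1, by omega⟩, by omega, by nlinarith⟩, ?_, ?_⟩
  · rw [lt_div_iff₀ hm0, hnr]; exact hn2
  · rwa [div_lt_iff₀ hm0]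

theorem Ioi_one_subset_closure_exponentSet : Ioi (1 : ℝ) ⊆ closure exponentSet := by
  intro p hp
  rw [Metric.mem_closure_iff]
  intro ε hε
  have hp1 : 1 < p := hp
  have hp2 : p < p + ε := by linarith
  have h1 := phiStar_lt_phiStar hp1 hp2
  have hφ := phiStar_mem_Ioo hp1
  have hφ' := phiStar_mem_Ioo (hp1.trans hp2)
  obtain ⟨m, n, hmn, ha, hb⟩ := exists_admissiblePair_between (a := phiStar (p + ε) / π)
    (b := phiStar p / π) (div_pos hφ'.1 pi_pos) (by gcongr)
    (by rw [div_lt_iff₀ pi_pos]; linarith [hφ.2])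
  rw [div_lt_iff₀ pi_pos] at ha
  rw [lt_div_iff₀ pi_pos] at hb
  obtain ⟨r, ⟨hr, hrφ⟩, -⟩ := existsUnique_isExponent hmn
  refine ⟨r, ⟨m, n, hmn, hr, hrφ⟩, ?_⟩
  have hpr : p < r := by
    by_contra! hle
    rcases hle.eq_or_lt with rfl | hlt
    · linarith
    · linarith [phiStar_lt_phiStar hr hlt]
  have hrp : r < p + ε := by
    by_contra! hle
    rcases hle.eq_or_lt with rfl | hlt
    · linarith
    · linarith [phiStar_lt_phiStar (hp1.trans hp2) hlt]
  rw [dist_comm, dist_eq, abs_of_pos (by linarith)]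
  linarith

/-! ### Closed `C²` curves as Sobolev immersions -/

lemma velocity_eq {γ : UnitAddCircle → Plane} {g' : ℝ → Plane}
    (h : ∀ t, HasDerivAt (lift γ) (g' t) t) : velocity γ = g' := funext fun t => (h t).deriv

lemma periodic_lift (γ : UnitAddCircle → Plane) : Function.Periodic (lift γ) 1 := fun t => by
  simp only [lift, AddCircle.coe_add, AddCircle.coe_period, add_zero]

lemma periodic_of_hasDerivAt {E : Type*} [NormedAddCommGroup E] [NormedSpace ℝ E] {g g' : ℝ → E} {c : ℝ}
    (hg : Function.Periodic g c) (h : ∀ t, HasDerivAt g (g' t) t) : Function.Periodic g' c := by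
  intro t
  have h1 := (h (t + c)).comp_add_const t c
  rw [show (fun x => g (x + c)) = g from funext hg] at h1
  exact h1.unique (h t)

lemma continuous_periodic_lift {E : Type*} [TopologicalSpace E] {g : ℝ → E} (hg : Function.Periodic g (1 : ℝ))
    (hc : Continuous g) : Continuous (hg.lift : UnitAddCircle → E) :=
  continuous_coinduced_dom.2 hc

lemma memLp_of_continuous {u : UnitAddCircle → Plane} (hu : Continuous u) (p : ENNReal) :
    MemLp u p volume := by
  obtain ⟨C, hC⟩ := isCompact_univ.exists_bound_of_continuousOn hu.continuousOn
  exact MemLp.of_bound hu.aestronglyMeasurable C (Filter.Eventually.of_forall fun x => hC x (mem_univ x))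

/-- Integration by parts over one period; the boundary terms cancel by periodicity. -/
lemma hasWeakDeriv_of_hasDerivAt {u v : UnitAddCircle → Plane} (hv : Continuous v)
    (h : ∀ t : ℝ, HasDerivAt (fun t : ℝ => u t) (v t) t) : HasWeakDeriv u v := by
  intro φ hφ hper
  have hd : ∀ t, HasDerivAt φ (deriv φ t) t := fun t =>
    (hφ.differentiable (by simp)).differentiableAt.hasDerivAt
  have hvc : Continuous fun t : ℝ => v t := hv.comp (AddCircle.continuous_mk' 1)
  have key := intervalIntegral.integral_smul_deriv_eq_deriv_smul (a := (0 : ℝ)) (b := 1)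
    (u := φ) (v := fun t : ℝ => u t) (fun t _ => hd t) (fun t _ => h t)
    ((hφ.continuous_deriv (by simp)).intervalIntegrable _ _) (hvc.intervalIntegrable _ _)
  have h1 : φ 1 = φ 0 := by simpa using hper 0
  have h2 : ((1 : ℝ) : UnitAddCircle) = ((0 : ℝ) : UnitAddCircle) := by
    rw [AddCircle.coe_period, AddCircle.coe_zero]
  rw [h1, h2, sub_self, zero_sub] at key
  rw [key, neg_neg]

lemma mem_W2pImm_of_hasDerivAt {γ : UnitAddCircle → Plane} {g' g'' : ℝ → Plane} (p : ℝ)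
    (h : ∀ t, HasDerivAt (lift γ) (g' t) t) (h' : ∀ t, HasDerivAt g' (g'' t) t)
    (hc : Continuous g'') (hne : ∀ t, g' t ≠ 0) : γ ∈ W2pImm p := by
  have hper' := periodic_of_hasDerivAt (periodic_lift γ) h
  have hper'' := periodic_of_hasDerivAt hper' h'
  have hγ : Continuous γ := continuous_coinduced_dom.2
    (continuous_iff_continuousAt.2 fun t => (h t).continuousAt)
  have hv : Continuous (hper'.lift : UnitAddCircle → Plane) :=
    continuous_periodic_lift hper' (continuous_iff_continuousAt.2 fun t => (h' t).continuousAt)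
  have hw := continuous_periodic_lift hper'' hc
  refine ⟨hγ, ⟨hper'.lift, hper''.lift, memLp_of_continuous hγ _, memLp_of_continuous hv _,
    memLp_of_continuous hw _, hasWeakDeriv_of_hasDerivAt hv h, hasWeakDeriv_of_hasDerivAt hw h'⟩, ?_⟩
  rw [velocity_eq h]
  exact hne

/-! ### Planar curves with prescribed curvature -/

/-- The unit vector at angle `a`. -/
noncomputable def unitVec (a : ℝ) : Plane :=
  cos a • EuclideanSpace.single 0 1 + sin a • EuclideanSpace.single 1 1

@[simp] lemma unitVec_apply_zero (a : ℝ) : unitVec a 0 = cos a := by simp [unitVec]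

@[simp] lemma unitVec_apply_one (a : ℝ) : unitVec a 1 = sin a := by simp [unitVec]

lemma norm_unitVec (a : ℝ) : ‖unitVec a‖ = 1 := by
  rw [EuclideanSpace.norm_eq, Fin.sum_univ_two]
  simp

lemma hasDerivAt_unitVec (a : ℝ) : HasDerivAt unitVec (unitVec (a + π / 2)) a := by
  have := ((hasDerivAt_cos a).smul_const (EuclideanSpace.single 0 1 : Plane)).add
    ((hasDerivAt_sin a).smul_const (EuclideanSpace.single 1 1 : Plane))
  rw [unitVec, cos_add_pi_div_two, sin_add_pi_div_two]
  exact this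

lemma continuous_unitVec : Continuous unitVec :=
  continuous_iff_continuousAt.2 fun a => (hasDerivAt_unitVec a).continuousAt

lemma unitVec_add (a b : ℝ) : unitVec (a + b) = cos b • unitVec a + sin b • unitVec (a + π / 2) := by
  ext i
  fin_cases i
  · simp [cos_add]; ring
  · simp [sin_add]; ring

lemma unitVec_add_int_mul_two_pi (a : ℝ) (n : ℤ) : unitVec (a + n * (2 * π)) = unitVec a := by
  rw [unitVec, cos_add_int_mul_two_pi, sin_add_int_mul_two_pi, unitVec]

/-- The tangential angle of the planar curve with curvature `k`. -/
noncomputable def angle (k : ℝ → ℝ) (t : ℝ) : ℝ := ∫ τ in (0 : ℝ)..t, k τ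

/-- The unit-speed planar curve with curvature `k` starting at the origin. -/
noncomputable def curve (k : ℝ → ℝ) (t : ℝ) : Plane := ∫ τ in (0 : ℝ)..t, unitVec (angle k τ)

section

variable {k : ℝ → ℝ}

lemma hasDerivAt_angle (hk : Continuous k) (t : ℝ) : HasDerivAt (angle k) (k t) t :=
  intervalIntegral.integral_hasDerivAt_right (hk.intervalIntegrable _ _)
    (hk.stronglyMeasurableAtFilter _ _) hk.continuousAt

lemma continuous_angle (hk : Continuous k) : Continuous (angle k) :=
  continuous_iff_continuousAt.2 fun t => (hasDerivAt_angle hk t).continuousAt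

lemma continuous_unitVec_angle (hk : Continuous k) : Continuous fun t => unitVec (angle k t) :=
  continuous_unitVec.comp (continuous_angle hk)

lemma hasDerivAt_curve (hk : Continuous k) (t : ℝ) : HasDerivAt (curve k) (unitVec (angle k t)) t :=
  have h := continuous_unitVec_angle hk
  intervalIntegral.integral_hasDerivAt_right (h.intervalIntegrable _ _)
    (h.stronglyMeasurableAtFilter _ _) h.continuousAt

lemma angle_add (hk : Continuous k) (a t : ℝ) : angle k (a + t) = angle k a + ∫ τ in (0 : ℝ)..t, k (τ + a) := by
  rw [intervalIntegral.integral_comp_add_right, zero_add, add_comm t a, angle, angle,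
    intervalIntegral.integral_add_adjacent_intervals (hk.intervalIntegrable _ _) (hk.intervalIntegrable _ _)]

lemma curve_add (hk : Continuous k) (a t : ℝ) :
    curve k (a + t) = curve k a + ∫ τ in (0 : ℝ)..t, unitVec (angle k (τ + a)) := by
  have h := continuous_unitVec_angle hk
  rw [intervalIntegral.integral_comp_add_right (fun τ => unitVec (angle k τ)), zero_add, add_comm t a,
    curve, curve,
    intervalIntegral.integral_add_adjacent_intervals (h.intervalIntegrable _ _) (h.intervalIntegrable _ _)]

/-- The curve with curvature `k`, periodic of period `M`, closes up after time `M` and can be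
reparametrized over the unit circle. -/
lemma exists_closed_curve (hk : Continuous k) {M : ℕ} (hM : 0 < M) (hper : Function.Periodic k M)
    {N : ℤ} (hN : angle k M = N * (2 * π)) (h0 : ∀ n : ℕ, curve k n = 0) (p : ℝ) :
    ∃ γ ∈ W2pImm p, HasPointOfMultiplicity γ M ∧
      normalizedBendingEnergy p γ = (M : ℝ) ^ (p - 1) * ∫ t in (0 : ℝ)..M, |k t| ^ p := by
  have hM0 : (0 : ℝ) < M := by exact_mod_cast hM
  have hangle : ∀ t, unitVec (angle k (t + M)) = unitVec (angle k t) := by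
    intro t
    rw [add_comm t, angle_add hk]
    have hper' : ∀ τ, k (τ + M) = k τ := hper
    simp_rw [hper']
    rw [hN, add_comm, unitVec_add_int_mul_two_pi, angle]
  have hcurve : ∀ t, curve k (M + t) = curve k t := by
    intro t
    rw [curve_add hk, h0]
    simp_rw [hangle]
    rw [zero_add, curve]
  have hg : Function.Periodic (fun u : ℝ => curve k (M * u)) (1 : ℝ) := fun u => by
    change curve k (M * (u + 1)) = curve k (M * u)
    rw [mul_add, mul_one, add_comm, hcurve]
  set γ : UnitAddCircle → Plane := hg.lift with hγ
  have hd : ∀ u, HasDerivAt (lift γ) ((M : ℝ) • unitVec (angle k (M * u))) u := by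
    intro u
    have h1 : HasDerivAt (fun u : ℝ => (M : ℝ) * u) M u := by
      simpa using (hasDerivAt_id u).const_mul (M : ℝ)
    exact (hasDerivAt_curve hk (M * u)).scomp u h1
  have hd' : ∀ u, HasDerivAt (fun u => (M : ℝ) • unitVec (angle k (M * u)))
      ((M : ℝ) • ((k (M * u) * M) • unitVec (angle k (M * u) + π / 2))) u := by
    intro u
    have h1 : HasDerivAt (fun u : ℝ => (M : ℝ) * u) M u := by
      simpa using (hasDerivAt_id u).const_mul (M : ℝ)
    have h2 : HasDerivAt (fun u : ℝ => angle k (M * u)) (k (M * u) * M) u :=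
      (hasDerivAt_angle hk (M * u)).comp u h1
    exact ((hasDerivAt_unitVec _).scomp u h2).const_smul (M : ℝ)
  have hvel := velocity_eq hd
  have hacc : acceleration γ = fun u => (M : ℝ) • ((k (M * u) * M) • unitVec (angle k (M * u) + π / 2)) := by
    rw [acceleration, hvel]
    exact funext fun u => (hd' u).deriv
  have hnorm : ∀ u, ‖velocity γ u‖ = M := fun u => by
    rw [hvel, norm_smul, norm_unitVec, mul_one, norm_of_nonneg hM0.le]
  have hcurv : ∀ u, curvature γ u = k (M * u) := by
    intro u
    rw [curvature, hnorm, hvel, hacc, div_eq_iff (by positivity)]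
    simp only [PiLp.smul_apply, unitVec_apply_zero, unitVec_apply_one, smul_eq_mul, cos_add_pi_div_two,
      sin_add_pi_div_two]
    linear_combination (k (M * u) * M ^ 3) * sin_sq_add_cos_sq (angle k (M * u))
  refine ⟨γ, mem_W2pImm_of_hasDerivAt p hd hd' ?_ ?_, ⟨0, ?_⟩, ?_⟩
  · have := continuous_unitVec
    have := continuous_angle hk
    fun_prop
  · intro t ht
    have := hnorm t
    rw [hvel] at this
    simp only [ht, norm_zero] at this
    exact hM0.ne this
  · have hinj : Function.Injective fun i : Fin M => (((i : ℕ) / M : ℝ) : UnitAddCircle) := by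
      have hmem : ∀ i : Fin M, ((i : ℕ) / M : ℝ) ∈ Ico (0 : ℝ) (0 + 1) := fun i => by
        have hi : ((i : ℕ) : ℝ) < M := by exact_mod_cast i.2
        refine ⟨by positivity, ?_⟩
        rw [zero_add, div_lt_one hM0]
        exact hi
      intro i j hij
      have h1 := (AddCircle.coe_eq_coe_iff_of_mem_Ico (hmem i) (hmem j)).1 hij
      rw [div_left_inj' hM0.ne'] at h1
      exact Fin.ext (by exact_mod_cast h1)
    have hsub : range (fun i : Fin M => (((i : ℕ) / M : ℝ) : UnitAddCircle)) ⊆ γ ⁻¹' {0} := by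
      rintro _ ⟨i, rfl⟩
      change curve k (M * ((i : ℕ) / M)) = 0
      rw [mul_div_cancel₀ _ hM0.ne', h0]
    refine le_trans ?_ (encard_le_encard hsub)
    rw [← image_univ, hinj.encard_image, encard_univ]
    simp
  · have hlen : length γ = M := by simp [length, hnorm]
    rw [normalizedBendingEnergy, hlen, bendingEnergy]
    simp_rw [hcurv, hnorm]
    rw [intervalIntegral.integral_mul_const, mul_comm _ (M : ℝ),
      intervalIntegral.mul_integral_comp_mul_left (f := fun t => |k t| ^ p), mul_zero, mul_one]

end

/-! ### Concatenating loops -/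

/-- The sign can jump only at integers, where κ vanishes. This is what allows copies of opposite
orientation to be joined with continuous curvature. -/
lemma continuous_floor_mul {ε : ℤ → ℝ} (hε : ∀ i, |ε i| = 1) {κ : ℝ → ℝ} (hκ : Continuous κ)
    (h0 : ∀ i : ℤ, κ i = 0) : Continuous fun t => ε ⌊t⌋ * κ t := by
  refine continuous_iff_continuousAt.2 fun t => ?_
  by_cases ht : κ t = 0
  · rw [ContinuousAt, ht, mul_zero]
    refine squeeze_zero_norm (a := fun t => |κ t|) (fun x => ?_) ?_
    · rw [norm_mul, norm_eq_abs, hε, one_mul, norm_eq_abs]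
    · simpa [ht] using (hκ.abs.tendsto t)
  · have hlt : (⌊t⌋ : ℝ) < t := lt_of_le_of_ne (Int.floor_le t) fun h => ht (h ▸ h0 _)
    have hev : (fun x => ε ⌊x⌋ * κ x) =ᶠ[nhds t] fun x => ε ⌊t⌋ * κ x := by
      filter_upwards [Ioo_mem_nhds hlt (Int.lt_floor_add_one t)] with x hx
      rw [Int.floor_eq_iff.2 ⟨hx.1.le, hx.2⟩]
    exact (continuous_const.mul hκ).continuousAt.congr hev.symm

/-- Given the curvature `κ` of a loop `[0, 1] → ℝ²`, vanishing at the endpoints, `M` congruent copies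
of the loop with orientations `ε` are concatenated to a closed curve as soon as the total turning is a
multiple of `2 π`. -/
theorem exists_closed_curve_of_loop {κ : ℝ → ℝ} (hκ : Continuous κ) (hκper : Function.Periodic κ (1 : ℝ))
    (hκ0 : κ 0 = 0) (hcos : ∫ t in (0 : ℝ)..1, cos (angle κ t) = 0)
    (hsin : ∫ t in (0 : ℝ)..1, sin (angle κ t) = 0) {M : ℕ} (hM : 0 < M) {ε : ℤ → ℝ}
    (hε : ∀ i, ε i = 1 ∨ ε i = -1) (hεper : ∀ i, ε (i + M) = ε i) {N : ℤ}
    (hN : (∑ i ∈ Finset.range M, ε i) * angle κ 1 = N * (2 * π)) {p : ℝ} (hp : 0 ≤ p) :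
    ∃ γ ∈ W2pImm p, HasPointOfMultiplicity γ M ∧
      normalizedBendingEnergy p γ = (M : ℝ) ^ p * ∫ t in (0 : ℝ)..1, |κ t| ^ p := by
  have hM0 : (0 : ℝ) < M := by exact_mod_cast hM
  have habs : ∀ i, |ε i| = 1 := fun i => by rcases hε i with h | h <;> simp [h]
  have hκint : ∀ (i : ℤ) (t : ℝ), κ (t + i) = κ t := fun i t => by
    simpa using hκper.int_mul i t
  set k : ℝ → ℝ := fun t => ε ⌊t⌋ * κ t with hkdef
  have hk : Continuous k := continuous_floor_mul habs hκ fun i => by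
    rw [← zero_add (i : ℝ), hκint, hκ0]
  have hleaf : ∀ (n : ℕ), ∀ t ∈ Icc (0 : ℝ) 1, angle k (n + t) = angle k n + ε n * angle κ t := by
    intro n t ht
    rw [angle_add hk, angle, angle, ← intervalIntegral.integral_const_mul]
    congr 1
    refine intervalIntegral.integral_congr_Ioo_of_le ht.1 fun x hx => ?_
    have hfl : ⌊x + n⌋ = (n : ℤ) := by
      rw [Int.floor_eq_iff]
      push_cast
      exact ⟨by linarith [hx.1], by linarith [hx.2, ht.2]⟩
    have := hκint n x
    push_cast at this
    simp only [hkdef]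
    rw [hfl, this]
  have hnat : ∀ n : ℕ, angle k n = (∑ i ∈ Finset.range n, ε i) * angle κ 1 := by
    intro n
    induction n with
    | zero => simp [angle]
    | succ n ih =>
      rw [Nat.cast_succ, hleaf n 1 ⟨zero_le_one, le_rfl⟩, ih, Finset.sum_range_succ, add_mul]
  have hcurve : ∀ n : ℕ, curve k n = 0 := by
    intro n
    induction n with
    | zero => simp [curve]
    | succ n ih =>
      have hc : Continuous fun t => cos (angle κ t) := continuous_cos.comp (continuous_angle hκ)
      have hs : Continuous fun t => sin (angle κ t) := continuous_sin.comp (continuous_angle hκ)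
      rw [Nat.cast_succ, curve_add hk, ih, zero_add]
      -- In the frame at the start of the leaf, reversing the orientation only changes the sign of
      -- the sine component, so each leaf closes by `hcos` and `hsin` whatever its sign.
      have h1 : ∫ t in (0 : ℝ)..1, unitVec (angle k (t + n)) = ∫ t in (0 : ℝ)..1,
          (cos (angle κ t) • unitVec (angle k n) +
            sin (angle κ t) • (ε n • unitVec (angle k n + π / 2))) := by
        refine intervalIntegral.integral_congr fun t ht => ?_
        rw [uIcc_of_le zero_le_one] at ht
        rw [add_comm t, hleaf n t ht, unitVec_add]
        rcases hε n with h | h <;> simp [h]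
      rw [h1, intervalIntegral.integral_add
        (Continuous.intervalIntegrable (by fun_prop) _ _) (Continuous.intervalIntegrable (by fun_prop) _ _), intervalIntegral.integral_smul_const,
        intervalIntegral.integral_smul_const, hcos, hsin]
      simp
  have hper : Function.Periodic k M := by
    intro t
    have h1 := hκint M t
    push_cast at h1
    simp only [hkdef]
    rw [h1, Int.floor_add_natCast, hεper]
  obtain ⟨γ, hγ, hmult, hE⟩ := exists_closed_curve hk hM hper (by rw [hnat, hN]) hcurve p
  refine ⟨γ, hγ, hmult, ?_⟩
  have hint : ∫ t in (0 : ℝ)..M, |k t| ^ p = M * ∫ t in (0 : ℝ)..1, |κ t| ^ p := by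
    have h1 : ∀ t, |k t| ^ p = |κ t| ^ p := fun t => by simp only [hkdef, abs_mul, habs, one_mul]
    simp_rw [h1]
    have hc : Continuous fun t => |κ t| ^ p := hκ.abs.rpow_const fun _ => Or.inr hp
    have hper' : Function.Periodic (fun t => |κ t| ^ p) (1 : ℝ) := fun t => by simp only [hκper t]
    have := hper'.intervalIntegral_add_zsmul_eq M 0 fun a b => hc.intervalIntegrable a b
    simpa using this
  rw [hE, hint, ← mul_assoc, ← rpow_add_one hM0.ne', sub_add_cancel]

/-! ### Even and odd integrands -/

lemma intervalIntegrable_neg_of_even {f : ℝ → ℝ} {a : ℝ} (hf : ∀ x, f (-x) = f x)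
    (h : IntervalIntegrable f volume 0 a) : IntervalIntegrable f volume (-a) 0 := by
  have := (IntervalIntegrable.iff_comp_neg (f := f)).1 h
  simp only [hf, neg_zero] at this
  exact this.symm

lemma integral_even {f : ℝ → ℝ} {a : ℝ} (hf : ∀ x, f (-x) = f x)
    (h : IntervalIntegrable f volume 0 a) : ∫ x in (-a)..a, f x = 2 * ∫ x in (0 : ℝ)..a, f x := by
  have h1 := intervalIntegral.integral_comp_neg (a := 0) (b := a) f
  simp only [hf, neg_zero] at h1
  rw [← intervalIntegral.integral_add_adjacent_intervals (intervalIntegrable_neg_of_even hf h) h, ← h1]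
  ring

lemma integral_odd {f : ℝ → ℝ} (a : ℝ) (hf : ∀ x, f (-x) = -f x) : ∫ x in (-a)..a, f x = 0 := by
  have h1 := intervalIntegral.integral_comp_neg (a := -a) (b := a) f
  simp only [hf, neg_neg, intervalIntegral.integral_neg] at h1
  linarith

/-! ### The arclength weight -/

/-- The density `|cos x| ^ s / √(1 - q² sin² x)` of arclength, made positive at the zeros of the cosine. -/
noncomputable def weight (s q x : ℝ) : ℝ := exp (s * log (cos x)) / √(1 - q ^ 2 * sin x ^ 2)

section

variable {s q : ℝ}

lemma weight_pos (hq : q ∈ Ico (0 : ℝ) 1) (x : ℝ) : 0 < weight s q x :=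
  div_pos (exp_pos _) (sqrt_pos.2 (one_sub_sq_mul_sin_sq_pos hq x))

lemma weight_neg (x : ℝ) : weight s q (-x) = weight s q x := by simp [weight]

lemma weight_periodic : Function.Periodic (weight s q) π := fun x => by
  simp [weight, cos_add_pi, sin_add_pi]

lemma weight_of_cos_pos {x : ℝ} (hx : 0 < cos x) :
    weight s q x = |cos x| ^ s / √(1 - q ^ 2 * sin x ^ 2) := by
  rw [weight, abs_of_pos hx, rpow_def_of_pos hx, mul_comm]

lemma continuousAt_weight (hq : q ∈ Ico (0 : ℝ) 1) {x : ℝ} (hx : 0 < cos x) :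
    ContinuousAt (weight s q) x := by
  refine ContinuousAt.div ?_ (by fun_prop) (sqrt_pos.2 (one_sub_sq_mul_sin_sq_pos hq x)).ne'
  exact (continuousAt_const.mul (continuous_cos.continuousAt.log hx.ne')).rexp

lemma measurable_weight : Measurable (weight s q) := by
  unfold weight
  fun_prop

lemma intervalIntegrable_weight_half (hs : -1 < s) (hq : q ∈ Ico (0 : ℝ) 1) :
    IntervalIntegrable (weight s q) volume 0 (π / 2) := by
  have h1 : IntervalIntegrable (fun x => |cos x| ^ s * (√(1 - q ^ 2 * sin x ^ 2))⁻¹) volume 0 (π / 2) :=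
    (intervalIntegrable_abs_cos_rpow hs).mul_continuousOn (Continuous.inv₀ (by fun_prop)
      fun θ => (sqrt_pos.2 (one_sub_sq_mul_sin_sq_pos hq θ)).ne').continuousOn
  refine h1.congr_uIoo fun x hx => ?_
  rw [uIoo_of_le half_pi_nonneg] at hx
  simp only
  rw [weight_of_cos_pos (cos_pos_of_mem_Ioo_zero hx), div_eq_mul_inv]

lemma intervalIntegrable_weight (hs : -1 < s) (hq : q ∈ Ico (0 : ℝ) 1) (a b : ℝ) :
    IntervalIntegrable (weight s q) volume a b := by
  have h := intervalIntegrable_weight_half hs hq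
  refine weight_periodic.intervalIntegrable pi_ne_zero (t := -(π / 2)) ?_ a b
  rw [show -(π / 2) + π = π / 2 by ring]
  exact (intervalIntegrable_neg_of_even weight_neg h).trans h

lemma intervalIntegrable_mul_weight (hs : -1 < s) (hq : q ∈ Ico (0 : ℝ) 1) {f : ℝ → ℝ}
    (hf : Continuous f) (a b : ℝ) : IntervalIntegrable (fun x => f x * weight s q x) volume a b :=
  (intervalIntegrable_weight hs hq a b).continuousOn_mul hf.continuousOn

/-- The length of the arc over `[-π/2, π/2]`. -/
noncomputable def arcLength (s q : ℝ) : ℝ := ∫ x in (-(π / 2))..(π / 2), weight s q x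

lemma arcLength_pos (hs : -1 < s) (hq : q ∈ Ico (0 : ℝ) 1) : 0 < arcLength s q :=
  intervalIntegral.intervalIntegral_pos_of_pos (intervalIntegrable_weight hs hq _ _) (weight_pos hq)
    (by linarith [pi_pos])

/-- Arclength normalized so that a half period has length one. -/
noncomputable def arcParam (s q x : ℝ) : ℝ := (∫ y in (-(π / 2))..x, weight s q y) / arcLength s q

lemma continuous_arcParam (hs : -1 < s) (hq : q ∈ Ico (0 : ℝ) 1) : Continuous (arcParam s q) :=
  (intervalIntegral.continuous_primitive (intervalIntegrable_weight hs hq) _).div_const _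

lemma strictMono_arcParam (hs : -1 < s) (hq : q ∈ Ico (0 : ℝ) 1) : StrictMono (arcParam s q) := by
  intro a b hab
  refine div_lt_div_of_pos_right ?_ (arcLength_pos hs hq)
  have h := intervalIntegral.intervalIntegral_pos_of_pos (intervalIntegrable_weight (s := s) hs hq a b)
    (weight_pos hq) hab
  rw [← intervalIntegral.integral_add_adjacent_intervals (intervalIntegrable_weight hs hq _ a)
    (intervalIntegrable_weight hs hq a b)]
  linarith

lemma arcParam_int (hs : -1 < s) (hq : q ∈ Ico (0 : ℝ) 1) (n : ℤ) :
    arcParam s q (-(π / 2) + n * π) = n := by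
  have h := weight_periodic.intervalIntegral_add_zsmul_eq n (-(π / 2))
    (intervalIntegrable_weight (s := s) hs hq)
  rw [zsmul_eq_mul, zsmul_eq_mul, show -(π / 2) + π = π / 2 by ring] at h
  rw [arcParam, h, ← arcLength, mul_div_cancel_right₀ _ (arcLength_pos hs hq).ne']

lemma arcParam_add_pi (hs : -1 < s) (hq : q ∈ Ico (0 : ℝ) 1) (x : ℝ) :
    arcParam s q (x + π) = arcParam s q x + 1 := by
  have h := weight_periodic (s := s) (q := q) |>.intervalIntegral_add_eq x (-(π / 2))
  rw [show -(π / 2) + π = π / 2 by ring, ← arcLength] at h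
  rw [arcParam, ← intervalIntegral.integral_add_adjacent_intervals (intervalIntegrable_weight hs hq _ x)
    (intervalIntegrable_weight hs hq _ _), h, add_div, div_self (arcLength_pos hs hq).ne', arcParam]

lemma surjective_arcParam (hs : -1 < s) (hq : q ∈ Ico (0 : ℝ) 1) : Function.Surjective (arcParam s q) := by
  intro y
  refine mem_range_of_exists_le_of_exists_ge (continuous_arcParam hs hq)
    ⟨-(π / 2) + ⌊y⌋ * π, ?_⟩ ⟨-(π / 2) + (⌊y⌋ + 1 : ℤ) * π, ?_⟩
  · rw [arcParam_int hs hq]; exact Int.floor_le y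
  · rw [arcParam_int hs hq]; push_cast; exact (Int.lt_floor_add_one y).le

/-- The inverse of the arclength parameter is continuous, and differentiable where the cosine does not
vanish. -/
lemma exists_arcParam_inverse (hs : -1 < s) (hq : q ∈ Ico (0 : ℝ) 1) :
    ∃ X : ℝ → ℝ, Continuous X ∧ X 0 = -(π / 2) ∧ X 1 = π / 2 ∧ (∀ t, X (t + 1) = X t + π) ∧
      ∀ t ∈ Ioo (0 : ℝ) 1, 0 < cos (X t) ∧ HasDerivAt X (arcLength s q / weight s q (X t)) t := by
  set e := StrictMono.orderIsoOfSurjective _ (strictMono_arcParam hs hq) (surjective_arcParam hs hq) with he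
  have hTX : ∀ t, arcParam s q (e.symm t) = t := fun t => e.apply_symm_apply t
  have hinj := (strictMono_arcParam hs hq).injective
  have h0 : e.symm 0 = -(π / 2) := hinj (by
    rw [hTX]; simpa using (arcParam_int hs hq 0).symm)
  have h1 : e.symm 1 = π / 2 := hinj (by
    rw [hTX]
    have := arcParam_int hs hq 1
    rw [Int.cast_one, one_mul, show -(π / 2) + π = π / 2 by ring] at this
    exact this.symm)
  refine ⟨e.symm, e.symm.continuous, h0, h1, fun t => hinj ?_, fun t ht => ?_⟩
  · rw [hTX, arcParam_add_pi hs hq, hTX]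
  · have hcos : 0 < cos (e.symm t) := cos_pos_of_mem_Ioo
      ⟨h0 ▸ e.symm.strictMono ht.1, h1 ▸ e.symm.strictMono ht.2⟩
    refine ⟨hcos, ?_⟩
    have hd : HasDerivAt (arcParam s q) (weight s q (e.symm t) / arcLength s q) (e.symm t) :=
      (intervalIntegral.integral_hasDerivAt_right (intervalIntegrable_weight hs hq _ _)
        (measurable_weight.stronglyMeasurable.stronglyMeasurableAtFilter)
        (continuousAt_weight hq hcos)).div_const _
    have := HasDerivAt.of_local_left_inverse e.symm.continuous.continuousAt hd
      (div_pos (weight_pos hq _) (arcLength_pos hs hq)).ne' (Filter.Eventually.of_forall hTX)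
    rwa [inv_div] at this

/-- Change of variables from the normalized arclength to the angle. -/
lemma integral_comp_inverse (hs : -1 < s) (hq : q ∈ Ico (0 : ℝ) 1) {X : ℝ → ℝ} (hX : Continuous X)
    (hX0 : X 0 = -(π / 2)) (hX1 : X 1 = π / 2)
    (hXd : ∀ t ∈ Ioo (0 : ℝ) 1, 0 < cos (X t) ∧ HasDerivAt X (arcLength s q / weight s q (X t)) t)
    {f : ℝ → ℝ} (hf : Continuous f) :
    ∫ t in (0 : ℝ)..1, f (X t) = (∫ x in (-(π / 2))..(π / 2), f x * weight s q x) / arcLength s q := by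
  have hint := intervalIntegrable_mul_weight hs hq hf
  have hG := intervalIntegral.continuous_primitive hint (-(π / 2))
  -- The weight may vanish or blow up at ±π/2, so the derivative of X is used only inside (0, 1),
  -- with continuity at the ends.
  have key := intervalIntegral.integral_eq_sub_of_hasDerivAt_of_le
    (f := fun t => (∫ x in (-(π / 2))..(X t), f x * weight s q x) / arcLength s q)
    (f' := fun t => f (X t)) zero_le_one ((hG.comp hX).div_const _).continuousOn ?_
    ((hf.comp hX).intervalIntegrable _ _)
  · rw [key, hX0, hX1, intervalIntegral.integral_same, zero_div, sub_zero]
  · intro t ht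
    obtain ⟨hcos, hd⟩ := hXd t ht
    have h1 : HasDerivAt (fun y => ∫ x in (-(π / 2))..y, f x * weight s q x)
        (f (X t) * weight s q (X t)) (X t) :=
      intervalIntegral.integral_hasDerivAt_right (hint _ _)
        ((hf.measurable.mul measurable_weight).stronglyMeasurable.stronglyMeasurableAtFilter)
        (hf.continuousAt.mul (continuousAt_weight hq hcos))
    have h2 := (h1.comp t hd).div_const (arcLength s q)
    refine h2.congr_deriv ?_
    have := (weight_pos (s := s) hq (X t)).ne'
    have := (arcLength_pos hs hq).ne'
    field_simp

end

/-! ### The half-period loop of the figure-eight elastica -/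

lemma integral_weight_eq_K1 {p q : ℝ} (f : ℝ → ℝ) :
    ∫ x in (0 : ℝ)..(π / 2), f x * weight (1 - 2 / p) q x =
      ∫ x in (0 : ℝ)..(π / 2), f x * (|cos x| ^ (1 - 2 / p) / √(1 - q ^ 2 * sin x ^ 2)) :=
  intervalIntegral.integral_congr_Ioo_of_le half_pi_nonneg fun x hx => by
    simp only [weight_of_cos_pos (cos_pos_of_mem_Ioo_zero hx)]

lemma arcLength_eq {p q : ℝ} (hp : 1 < p) (hq : q ∈ Ico (0 : ℝ) 1) :
    arcLength (1 - 2 / p) q = 2 * K1 p q := by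
  rw [arcLength, integral_even weight_neg (intervalIntegrable_weight (exponent_mem_Ioo hp).1 hq _ _), K1]
  have := integral_weight_eq_K1 (p := p) (q := q) fun _ => 1
  simp only [one_mul] at this
  rw [this]

/-- Up to the factor `arcLength`, this is the displacement of the half period along its axis; it
vanishes exactly when 2E = K. -/
lemma integral_one_sub_mul_weight {p q : ℝ} (hp : 1 < p) (hq : q ∈ Ico (0 : ℝ) 1) :
    ∫ x in (-(π / 2))..(π / 2), (1 - 2 * (q * sin x) ^ 2) * weight (1 - 2 / p) q x =
      2 * (2 * E1 p q - K1 p q) := by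
  have hs := (exponent_mem_Ioo hp).1
  rw [integral_even (fun x => by rw [weight_neg, sin_neg]; ring)
    (intervalIntegrable_mul_weight hs hq (by fun_prop) _ _), integral_weight_eq_K1,
    two_mul_E1_sub_K1 hp hq, defect]
  congr 1
  refine intervalIntegral.integral_congr fun x _ => ?_
  simp only [kernelFun]
  ring

lemma sq_mul_integral_cos_sq_mul_weight {p q : ℝ} (hp : 1 < p) (hq : q ∈ Ico (0 : ℝ) 1) :
    q ^ 2 * ∫ x in (-(π / 2))..(π / 2), cos x ^ 2 * weight (1 - 2 / p) q x =
      2 * (E1 p q - (1 - q ^ 2) * K1 p q) := by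
  have hs := (exponent_mem_Ioo hp).1
  rw [integral_even (fun x => by rw [weight_neg, cos_neg])
    (intervalIntegrable_mul_weight hs hq (by fun_prop) _ _), integral_weight_eq_K1, mul_left_comm]
  congr 1
  rw [← intervalIntegral.integral_const_mul, E1, K1, ← intervalIntegral.integral_const_mul,
    ← intervalIntegral.integral_sub (intervalIntegrable_E1 hp) ((intervalIntegrable_K1 hp hq).const_mul _)]
  refine intervalIntegral.integral_congr fun x _ => ?_
  have h1 := one_sub_sq_mul_sin_sq_pos hq x
  have h2 := sqrt_pos.2 h1
  have h3 := sq_sqrt h1.le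
  have h4 := sin_sq_add_cos_sq x
  generalize |cos x| ^ (1 - 2 / p) = A
  field_simp
  rw [h3]
  linear_combination A * q ^ 2 * h4

lemma K1_eq_two_mul_E1 {p : ℝ} (hp : 1 < p) : K1 p (qStar p) = 2 * E1 p (qStar p) := by
  have := two_mul_E1_sub_K1 hp (qStar_mem_Ico hp)
  rw [defect_qStar hp] at this
  linarith

/-- The curvature of the loop: a half period of the figure-eight `p`-elastica, which closes up, turns by
`4 arcsin q^*`, and whose curvature vanishes at the endpoints. -/
theorem exists_loop {p : ℝ} (hp : 1 < p) :
    ∃ κ : ℝ → ℝ, Continuous κ ∧ Function.Periodic κ (1 : ℝ) ∧ κ 0 = 0 ∧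
      ∫ t in (0 : ℝ)..1, cos (angle κ t) = 0 ∧ ∫ t in (0 : ℝ)..1, sin (angle κ t) = 0 ∧
      angle κ 1 = 4 * arcsin (qStar p) ∧ ∫ t in (0 : ℝ)..1, |κ t| ^ p = varpiStar p := by
  have hs := (exponent_mem_Ioo hp).1
  have hp0 : 0 < p := by linarith
  set q := qStar p with hqdef
  have hq : q ∈ Ico (0 : ℝ) 1 := qStar_mem_Ico hp
  have hq0 : 0 < q := (qStar_mem_Ioo hp).1
  obtain ⟨X, hX, hX0, hX1, hXper, hXd⟩ := exists_arcParam_inverse hs hq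
  have hL := arcLength_pos hs hq
  have hL2 := arcLength_eq hp hq
  have hKE : K1 p q = 2 * E1 p q := K1_eq_two_mul_E1 hp
  have hcov := fun {f : ℝ → ℝ} (hf : Continuous f) => integral_comp_inverse hs hq hX hX0 hX1 hXd hf
  set L := arcLength (1 - 2 / p) q with hLdef
  -- This is the derivative of D(X t): D' = 2q cos/√(1 - q² sin²) and X' = L/weight, which leaves
  -- |cos|^(2/p).
  set κ : ℝ → ℝ := fun t => 2 * L * q * |cos (X t)| ^ (2 / p) with hκdef
  have hκ : Continuous κ := continuous_const.mul
    ((continuous_cos.comp hX).abs.rpow_const fun _ => Or.inr (by positivity))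
  set D : ℝ → ℝ := fun x => 2 * arcsin (q * sin x) with hDdef
  have hD : Continuous D := continuous_const.mul (continuous_arcsin.comp (by fun_prop))
  have habs : ∀ x, |q * sin x| < 1 := fun x => by
    rw [abs_mul, abs_of_nonneg hq.1]
    nlinarith [abs_sin_le_one x, abs_nonneg (sin x), hq.1, hq.2]
  have hangle : ∀ t ∈ Icc (0 : ℝ) 1, angle κ t = D (X t) + 2 * arcsin q := by
    intro t ht
    have key := intervalIntegral.integral_eq_sub_of_hasDerivAt_of_le (f := fun τ => D (X τ)) (f' := κ)
      ht.1 (hD.comp hX).continuousOn ?_ (hκ.intervalIntegrable _ _)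
    · rw [angle, key]
      simp only [hDdef]
      rw [hX0, sin_neg, sin_pi_div_two, mul_neg_one, arcsin_neg]
      ring
    · intro τ hτ
      obtain ⟨hcos, hd⟩ := hXd τ ⟨hτ.1, hτ.2.trans_le ht.2⟩
      have hb := abs_lt.1 (habs (X τ))
      have h1 := ((hasDerivAt_arcsin hb.1.ne' hb.2.ne).comp τ
        (((hasDerivAt_sin _).comp τ hd).const_mul q)).const_mul 2
      refine h1.congr_deriv ?_
      have h2 := sqrt_pos.2 (one_sub_sq_mul_sin_sq_pos hq (X τ))
      have hsplit : |cos (X τ)| ^ (2 / p) * |cos (X τ)| ^ (1 - 2 / p) = cos (X τ) := by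
        rw [← rpow_add (abs_pos.2 hcos.ne'), add_sub_cancel, rpow_one, abs_of_pos hcos]
      have h3 : 0 < |cos (X τ)| ^ (1 - 2 / p) := rpow_pos_of_pos (abs_pos.2 hcos.ne') _
      simp only [hκdef]
      rw [weight_of_cos_pos hcos, mul_pow]
      generalize |cos (X τ)| ^ (1 - 2 / p) = A at hsplit h3 ⊢
      generalize |cos (X τ)| ^ (2 / p) = B at hsplit ⊢
      rw [← hsplit]
      field_simp
  have hcosD : ∫ t in (0 : ℝ)..1, cos (D (X t)) = 0 := by
    rw [hcov (f := fun x => cos (D x)) (continuous_cos.comp hD)]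
    have h1 : ∀ x, cos (D x) = 1 - 2 * (q * sin x) ^ 2 := fun x => by
      have hb := abs_lt.1 (habs x)
      simp only [hDdef]
      rw [cos_two_mul, cos_sq', sin_arcsin hb.1.le hb.2.le]
      ring
    simp_rw [h1]
    rw [integral_one_sub_mul_weight hp hq, hKE, sub_self, mul_zero, zero_div]
  -- D is odd and the weight is even.
  have hsinD : ∫ t in (0 : ℝ)..1, sin (D (X t)) = 0 := by
    rw [hcov (f := fun x => sin (D x)) (continuous_sin.comp hD), integral_odd, zero_div]
    intro x
    simp only [hDdef, weight_neg, sin_neg, mul_neg, arcsin_neg, neg_mul]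
  have hic : IntervalIntegrable (fun t => cos (D (X t))) volume 0 1 :=
    (continuous_cos.comp (hD.comp hX)).intervalIntegrable _ _
  have his : IntervalIntegrable (fun t => sin (D (X t))) volume 0 1 :=
    (continuous_sin.comp (hD.comp hX)).intervalIntegrable _ _
  refine ⟨κ, hκ, fun t => ?_, ?_, ?_, ?_, ?_, ?_⟩
  · simp only [hκdef, hXper, cos_add_pi, abs_neg]
  · simp only [hκdef, hX0, cos_neg, cos_pi_div_two, abs_zero]
    rw [zero_rpow (by positivity), mul_zero]
  · have h1 : ∫ t in (0 : ℝ)..1, cos (angle κ t) = ∫ t in (0 : ℝ)..1,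
        (cos (D (X t)) * cos (2 * arcsin q) - sin (D (X t)) * sin (2 * arcsin q)) := by
      refine intervalIntegral.integral_congr fun t ht => ?_
      rw [uIcc_of_le zero_le_one] at ht
      simp only [hangle t ht, cos_add]
    rw [h1, intervalIntegral.integral_sub (hic.mul_const _) (his.mul_const _),
      intervalIntegral.integral_mul_const, intervalIntegral.integral_mul_const, hcosD, hsinD]
    ring
  · have h1 : ∫ t in (0 : ℝ)..1, sin (angle κ t) = ∫ t in (0 : ℝ)..1,
        (sin (D (X t)) * cos (2 * arcsin q) + cos (D (X t)) * sin (2 * arcsin q)) := by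
      refine intervalIntegral.integral_congr fun t ht => ?_
      rw [uIcc_of_le zero_le_one] at ht
      simp only [hangle t ht, sin_add]
    rw [h1, intervalIntegral.integral_add (his.mul_const _) (hic.mul_const _),
      intervalIntegral.integral_mul_const, intervalIntegral.integral_mul_const, hcosD, hsinD]
    ring
  · rw [hangle 1 ⟨zero_le_one, le_rfl⟩, hX1]
    simp only [hDdef, sin_pi_div_two, mul_one]
    ring
  · have h1 : ∀ t, |κ t| ^ p = (2 * L * q) ^ p * cos (X t) ^ 2 := fun t => by
      simp only [hκdef]
      rw [abs_of_nonneg (by positivity), mul_rpow (by positivity) (by positivity),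
        ← rpow_mul (abs_nonneg _), div_mul_cancel₀ _ hp0.ne', rpow_two, sq_abs]
    simp_rw [h1]
    rw [intervalIntegral.integral_const_mul, hcov (f := fun x => cos x ^ 2) (by fun_prop)]
    have hJ := sq_mul_integral_cos_sq_mul_weight hp hq
    have hE0 : 0 < E1 p q := by linarith [K1_pos hp hq]
    have hJ' : ∫ x in (-(π / 2))..(π / 2), cos x ^ 2 * weight (1 - 2 / p) q x =
        2 * (2 * q ^ 2 - 1) * E1 p q / q ^ 2 := by
      rw [eq_div_iff (by positivity), mul_comm, hJ, hKE]
      ring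
    -- Here L = 2K = 4E, so 2Lq = 8qE, and dividing by L cancels one factor E.
    rw [hJ', hL2, hKE, varpiStar, ← hqdef, show 2 * (2 * (2 * E1 p q)) * q = 2 ^ 3 * q * E1 p q by ring,
      mul_rpow (by positivity) hE0.le, mul_rpow (by positivity) hq0.le, ← rpow_natCast 2 3,
      ← rpow_mul (by norm_num), rpow_sub (by norm_num), rpow_one, rpow_sub hq0, rpow_two]
    push_cast
    field_simp

/-! ### The main theorem -/

lemma sum_range_sign (j r : ℕ) :
    ∑ i ∈ Finset.range (j + r), (if ((i : ℕ) : ℤ) % ((j + r : ℕ) : ℤ) < j then (-1 : ℝ) else 1) = r - j := by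
  have h : ∀ i ∈ Finset.range (j + r),
      (if ((i : ℕ) : ℤ) % ((j + r : ℕ) : ℤ) < j then (-1 : ℝ) else 1) = if i < j then -1 else 1 := by
    intro i hi
    rw [Int.emod_eq_of_lt (by positivity) (by exact_mod_cast Finset.mem_range.1 hi)]
    simp
  rw [Finset.sum_congr rfl h, Finset.sum_range_add, Finset.sum_congr rfl (g := fun _ => (-1 : ℝ))
    (fun i hi => if_pos (Finset.mem_range.1 hi)), Finset.sum_congr rfl (g := fun _ => (1 : ℝ))
    (s₁ := Finset.range r) (fun i _ => if_neg (by omega))]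
  simp
  ring

theorem exists_optimal_curve {m n : ℕ} {p : ℝ} (hmn : AdmissiblePair m n) (h : IsExponent m n p) {m' : ℕ}
    (hm' : Odd m') (hle : m ≤ m') :
    ∃ γ ∈ W2pImm p, HasPointOfMultiplicity γ m' ∧
      normalizedBendingEnergy p γ = varpiStar p * (m' : ℝ) ^ p := by
  obtain ⟨hp, hφ⟩ := h
  have hm0 : (0 : ℝ) < m := by exact_mod_cast (by linarith [hmn.1] : 0 < m)
  -- In each period j leaves get sign -1 and m + j get sign +1, so the signs add up to m.
  obtain ⟨j, hj⟩ : ∃ j, m' = j + (m + j) := by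
    obtain ⟨a, ha⟩ := hmn.2.1
    obtain ⟨b, hb⟩ := hm'
    exact ⟨b - a, by omega⟩
  obtain ⟨κ, hκ, hper, h0, hcos, hsin, hturn, hE⟩ := exists_loop hp
  have hq : arcsin (qStar p) = (π - n / m * π) / 2 := by
    rw [phiStar] at hφ
    linarith
  obtain ⟨γ, hγ, hmult, hen⟩ := exists_closed_curve_of_loop hκ hper h0 hcos hsin (M := m')
    (by linarith [hmn.1]) (ε := fun i => if i % (m' : ℤ) < j then -1 else 1)
    (fun i => by by_cases hi : i % (m' : ℤ) < j <;> simp [hi]) (fun i => by simp)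
    (N := (m : ℤ) - n) (by
      rw [hj, sum_range_sign, hturn, hq]
      push_cast
      field_simp
      ring) (by linarith : 0 ≤ p)
  exact ⟨γ, hγ, hmult, by rw [hen, hE, mul_comm]⟩

end PElastica

theorem mainTheorem10 :
    (∀ p : ℝ, 1 < p → ∃! q : ℝ, PElastica.IsFigureEightModulus p q) ∧
    (∀ m n : ℕ, PElastica.AdmissiblePair m n → ∃! p : ℝ, PElastica.IsExponent m n p) ∧
    (PElastica.exponentSet ⊆ Set.Ioi (1 : ℝ) ∧
      Set.Ioi (1 : ℝ) ⊆ closure PElastica.exponentSet) ∧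
    (∀ (m n : ℕ) (p : ℝ), PElastica.AdmissiblePair m n → PElastica.IsExponent m n p →
      ∀ m' : ℕ, Odd m' → m ≤ m' →
        ∃ γ ∈ PElastica.W2pImm p,
          PElastica.HasPointOfMultiplicity γ m' ∧
          PElastica.normalizedBendingEnergy p γ = PElastica.varpiStar p * (m' : ℝ) ^ p) := by
  refine ⟨fun p hp => PElastica.existsUnique_isFigureEightModulus hp,
    fun m n h => PElastica.existsUnique_isExponent h,
    ⟨?_, PElastica.Ioi_one_subset_closure_exponentSet⟩,
    fun m n p hmn h m' hm' hle => PElastica.exists_optimal_curve hmn h hm' hle⟩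
  rintro p ⟨m, n, -, hp, -⟩
  exact hp
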